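/- **Theorem.** Let $2 < \beta < 3$, let $\alpha = (\beta-1)/2 \in (\tfrac12, 1)$, and let $C \in \mathbb{R}$. For $n \in \mathbb{N}$ put $R = 2\ln n + C$. The hyperbolic random graph $\mathcal{G}(n,\alpha,C)$ has $n$ nodes, which are placed independently at points $(r_v,\varphi_v)$ of the hyperbolic plane given in native polar coordinates: $\varphi_v$ is uniform on $[0,2\pi)$, and $r_v$ is independent of $\varphi_v$ with density $\rho(r) = \frac{\alpha\sinh(\alpha r)}{\cosh(\alpha R)-1}$ on $[0,R]$. Two distinct nodes $u,v$ are adjacent if and only if their hyperbolic distance $$\mathrm{d}(u,v) = \cosh^{-1}\bigl(\cosh r_u\cosh r_v - \sinh r_u\sinh r_v\cos(\varphi_u-\varphi_v)\bigr)$$ is at most $R$. (For small $n$ it may happen that $R\le 0$; the claim only concerns large $n$.) The giant component is the connected component with the largest number of nodes. Then the diameter of the giant component of $\mathcal{G}(n,\alpha,C)$ is $\Omega(\log n)$ with probability $1-n^{-\Omega(1)}$. That is, there are constants $c>0$ and $\gamma>0$, depending only on $\alpha$ and $C$, such that for all sufficiently large $n$, with probability at least $1-n^{-\gamma}$, every connected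 component of $\mathcal{G}(n,\alpha,C)$ with the maximum number of nodes has diameter at least $c\log n$. -/

import Mathlib

open MeasureTheory ProbabilityTheory Filter

noncomputable section

namespace HyperbolicRandomGraph

/-- The radius `R = 2 ln n + C` of the disc `D_n`. -/
def radius (C : ℝ) (n : ℕ) : ℝ := 2 * Real.log n + C

/-- The small relative angle `Δφ ∈ [0, π]` between two angular coordinates. -/
def relAngle (φ ψ : ℝ) : ℝ := Real.arccos (Real.cos (φ - ψ))

/-- The hyperbolic distance of two points in native polar coordinates `(r, φ)`. -/
def hdist (u v : ℝ × ℝ) : ℝ :=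
  Real.arcosh (Real.cosh u.1 * Real.cosh v.1 -
    Real.sinh u.1 * Real.sinh v.1 * Real.cos (relAngle u.2 v.2))

theorem hdist_comm (u v : ℝ × ℝ) : hdist u v = hdist v u := by
  have h : Real.cos (u.2 - v.2) = Real.cos (v.2 - u.2) := by
    rw [← Real.cos_neg, neg_sub]
  unfold hdist relAngle
  rw [h, mul_comm (Real.cosh u.1), mul_comm (Real.sinh u.1)]

/-- The density `ρ(r) = α sinh(α r) / (cosh(α R) - 1)` of the radial coordinate. -/
def radialDensity (α R r : ℝ) : ℝ := α * Real.sinh (α * r) / (Real.cosh (α * R) - 1)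

/-- The law of the radial coordinate: density `ρ` on `[0, R]`. -/
def radialLaw (α R : ℝ) : Measure ℝ :=
  (volume.restrict (Set.Icc 0 R)).withDensity fun r => ENNReal.ofReal (radialDensity α R r)

/-- The law of the angular coordinate: uniform on `[0, 2π)`. -/
def angularLaw : Measure ℝ := cond volume (Set.Ico 0 (2 * Real.pi))

/-- The law of the positions of the `n` nodes: independent points `(r_v, φ_v)`, with `r_v` and
`φ_v` independent. -/
def positionLaw (α C : ℝ) (n : ℕ) : Measure (Fin n → ℝ × ℝ) :=
  Measure.pi fun _ => (radialLaw α (radius C n)).prod angularLaw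

/-- The graph on the points `x 0, …, x (n - 1)`, in which two distinct nodes are adjacent when
their hyperbolic distance is at most `R`. With `x` distributed by `positionLaw α C n` and
`R = radius C n`, this is the hyperbolic random graph `G(n, α, C)`. -/
def graph (R : ℝ) {n : ℕ} (x : Fin n → ℝ × ℝ) : SimpleGraph (Fin n) where
  Adj u v := u ≠ v ∧ hdist (x u) (x v) ≤ R
  symm := ⟨fun u v h => ⟨h.1.symm, hdist_comm (x u) (x v) ▸ h.2⟩⟩
  loopless := ⟨fun _ h => h.1 rfl⟩

/-- A giant component: a connected component with the largest number of nodes. -/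
def IsGiant {n : ℕ} {G : SimpleGraph (Fin n)} (K : G.ConnectedComponent) : Prop :=
  ∀ K' : G.ConnectedComponent, K'.supp.ncard ≤ K.supp.ncard

end HyperbolicRandomGraph

end

namespace HyperbolicRandomGraph

/-! The giant component contains, with probability $1-n^{-\Omega(1)}$, a dangling path of
$\Theta(\log n)$ nodes near the boundary of the disc. Put $t=\varepsilon\log n$ with small
$\varepsilon$, and call nodes of radius at most $R-t$ deep.

The deep nodes lie in the giant (`mem_giant_of_radius_le`). Cut the disc into $N\approx
n^{1-\varepsilon}$ sectors. A sector expects about $n^{\varepsilon(1-\alpha)}$ deep nodes, so by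
$\alpha<1$ every sector has one, and deep nodes of neighbouring sectors are adjacent. Hence all deep
nodes lie in one component, which has at least $N$ nodes. Edges of any other component cannot pass
over a deep node (`hdist_le_of_cos_le`), so its nodes share a few consecutive sectors. The expected
number of node pairs that close is $O(n^{1+\varepsilon})$, far below $N^2$, so such a component has
fewer than $N$ nodes.

A dangling path hangs off some deep node. A pattern at angle $s/M$ consists of $L\approx c\log n$
path nodes spaced by about $e^{-R/2}$, a hook node at bounded depth, and a deep node adjacent to the
hook; no other node may lie in a surrounding fan. Then path nodes have neighbours only among the
path and the hook, and every such edge changes the angle by $O(e^{-R/2})$, so the diameter is at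
least of order $L$ (`sub_one_le_mul_diam_of_pattern`). As $ne^{-R/2}$ is constant, each box costs a
constant factor, and an empty fan of mass $O(Le^{-R/2})$ costs $e^{-O(L)}$; thus one pattern has
probability $n^{-O(c+\varepsilon)}$, and among $M=n^m$ angles many are expected. Fans at different
angles meet only at small radii, where the mass is $o(1/n)$ because $\alpha>1/2$, so occurrences are
nearly uncorrelated and the second moment method applies (`measureReal_no_path_le`,
`polySmall_no_path`). -/

/-! ### Hyperbolic geometry of adjacency -/

theorem hdist_le_iff {R : ℝ} (hR : 0 ≤ R) {u v : ℝ × ℝ} (hu : 0 ≤ u.1) (hv : 0 ≤ v.1) :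
    hdist u v ≤ R ↔
      Real.cosh u.1 * Real.cosh v.1 - Real.sinh u.1 * Real.sinh v.1 * Real.cos (u.2 - v.2)
        ≤ Real.cosh R := by
  have hs := mul_nonneg (Real.sinh_nonneg_iff.2 hu) (Real.sinh_nonneg_iff.2 hv)
  have h1 : 1 ≤ Real.cosh u.1 * Real.cosh v.1
      - Real.sinh u.1 * Real.sinh v.1 * Real.cos (u.2 - v.2) := by
    have h2 := Real.one_le_cosh (u.1 - v.1)
    rw [Real.cosh_sub] at h2
    nlinarith [Real.cos_le_one (u.2 - v.2)]
  have hc : Real.cos (relAngle u.2 v.2) = Real.cos (u.2 - v.2) :=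
    Real.cos_arccos (Real.neg_one_le_cos _) (Real.cos_le_one _)
  unfold hdist
  rw [hc]
  conv_lhs => rw [← Real.arcosh_cosh hR]
  exact Real.arcosh_le_arcosh (by linarith) (Real.cosh_pos R)

/-- The argument of arcosh is $\cosh(r_u-r_v)+\sinh r_u\sinh r_v(1-\cos\theta)$. Both summands are
at most $e^R/4$, by $\sinh r\le e^r/2$ and $1-\cos\theta\le\theta^2/2$, and $e^R/2\le\cosh R$. -/
theorem hdist_le_of_angle {R : ℝ} (hR : 0 ≤ R) {u v : ℝ × ℝ} (hu : 0 ≤ u.1) (hv : 0 ≤ v.1)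
    (hr : Real.cosh (u.1 - v.1) ≤ Real.exp R / 4)
    (hφ : Real.exp (u.1 + v.1) * (u.2 - v.2) ^ 2 ≤ 2 * Real.exp R) : hdist u v ≤ R := by
  rw [hdist_le_iff hR hu hv]
  have hsu := Real.sinh_nonneg_iff.2 hu
  have hsv := Real.sinh_nonneg_iff.2 hv
  have h1 : Real.sinh u.1 ≤ Real.exp u.1 / 2 := by
    rw [Real.sinh_eq]; linarith [Real.exp_pos (-u.1)]
  have h2 : Real.sinh v.1 ≤ Real.exp v.1 / 2 := by
    rw [Real.sinh_eq]; linarith [Real.exp_pos (-v.1)]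
  have h3 := Real.one_sub_sq_div_two_le_cos (x := u.2 - v.2)
  have h4 : Real.sinh u.1 * Real.sinh v.1 ≤ Real.exp (u.1 + v.1) / 4 := by
    rw [Real.exp_add]; nlinarith [Real.exp_pos u.1, Real.exp_pos v.1]
  rw [Real.cosh_sub] at hr
  have h5 : Real.exp R / 2 ≤ Real.cosh R := by
    rw [Real.cosh_eq]; linarith [Real.exp_pos (-R)]
  have h6 : Real.sinh u.1 * Real.sinh v.1 * (1 - Real.cos (u.2 - v.2))
      ≤ Real.exp (u.1 + v.1) / 4 * ((u.2 - v.2) ^ 2 / 2) :=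
    mul_le_mul h4 (by linarith) (by linarith [Real.cos_le_one (u.2 - v.2)])
      (by positivity)
  nlinarith

theorem exists_int_abs_sub_le_pi (θ : ℝ) : ∃ k : ℤ, |θ - 2 * Real.pi * k| ≤ Real.pi := by
  have hp := Real.pi_pos
  refine ⟨round (θ / (2 * Real.pi)), ?_⟩
  have h := abs_sub_round (θ / (2 * Real.pi))
  have h2 : θ - 2 * Real.pi * round (θ / (2 * Real.pi))
      = 2 * Real.pi * (θ / (2 * Real.pi) - round (θ / (2 * Real.pi))) := by
    field_simp
  rw [h2, abs_mul, abs_of_pos (by positivity)]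
  nlinarith

/-- Converse estimate for $v$ near the boundary. It follows from $\sinh r\ge e^r/4$ for $r\ge1$ and
$1-\cos\delta\ge2\delta^2/\pi^2$ on $[-\pi,\pi]$, which give $\delta^2\le8\pi^2e^{d-r_u}$, and
$8\pi^2<81$. -/
theorem angle_le_of_hdist_le {R d : ℝ} (hR : 0 ≤ R) {u v : ℝ × ℝ} (hu : 0 ≤ u.1)
    (hv : R - d ≤ v.1) (hv1 : 1 ≤ v.1) (hd : 0 ≤ d) (h : hdist u v ≤ R) :
    ∃ k : ℤ, |u.2 - v.2 - 2 * Real.pi * k| ≤ Real.pi ∧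
      |u.2 - v.2 - 2 * Real.pi * k| ≤ 9 * Real.exp (d / 2) * Real.exp (-u.1 / 2) := by
  rw [hdist_le_iff hR hu (by linarith)] at h
  obtain ⟨k, hk⟩ := exists_int_abs_sub_le_pi (u.2 - v.2)
  refine ⟨k, hk, ?_⟩
  have hpi : Real.pi < 3.15 := Real.pi_lt_d2
  have hpi0 := Real.pi_pos
  have hcos : Real.cos (u.2 - v.2) = Real.cos (u.2 - v.2 - 2 * Real.pi * k) := by
    rw [show u.2 - v.2 - 2 * Real.pi * k = u.2 - v.2 - k * (2 * Real.pi) by ring,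
      Real.cos_sub_int_mul_two_pi]
  rw [hcos] at h
  set δ := u.2 - v.2 - 2 * Real.pi * k
  have hq := Real.cos_le_one_sub_mul_cos_sq hk
  have hgrow : ∀ r : ℝ, 1 ≤ r → Real.exp r / 4 ≤ Real.sinh r := by
    intro r hr
    rw [Real.sinh_eq]
    have h1 : Real.exp (-r) ≤ 1 / 2 := by
      have := Real.add_one_le_exp r
      rw [Real.exp_neg, inv_le_comm₀ (Real.exp_pos r) (by norm_num)]; linarith
    have h2 := Real.add_one_le_exp r
    linarith
  have hexp1 : Real.exp 1 < 2.7182818286 := Real.exp_one_lt_d9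
  rcases lt_or_ge u.1 1 with hu1 | hu1
  -- For $r_u<1$ the claimed bound already exceeds $\pi$, as $9/2>\pi$.
  · refine hk.trans ?_
    have h1 : 1 ≤ Real.exp (d / 2) := Real.one_le_exp (by linarith)
    have h2 : (1 : ℝ) / 2 ≤ Real.exp (-u.1 / 2) := by
      have := Real.add_one_le_exp (-u.1 / 2)
      linarith
    nlinarith
  · have hsu := hgrow _ hu1
    have hsv := hgrow _ hv1
    have h1 : Real.cosh u.1 * Real.cosh v.1 - Real.sinh u.1 * Real.sinh v.1 ≥ 0 := by
      rw [← Real.cosh_sub]; exact (Real.cosh_pos _).le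
    have hss : Real.exp (u.1 + v.1) / 16 ≤ Real.sinh u.1 * Real.sinh v.1 := by
      rw [Real.exp_add]; nlinarith [Real.exp_pos u.1, Real.exp_pos v.1]
    have hch : Real.cosh R ≤ Real.exp R := by
      rw [Real.cosh_eq]
      have : Real.exp (-R) ≤ Real.exp R := Real.exp_le_exp.2 (by linarith)
      linarith
    have h2 : Real.exp (u.1 + v.1) / 16 * (2 / Real.pi ^ 2 * δ ^ 2) ≤ Real.exp R := by
      have : Real.sinh u.1 * Real.sinh v.1 * (1 - Real.cos δ) ≤ Real.exp R := by nlinarith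
      refine le_trans (mul_le_mul hss (by linarith) (by positivity) ?_) this
      exact le_trans (by positivity) hss
    have h3 : δ ^ 2 ≤ 8 * Real.pi ^ 2 * (Real.exp d * Real.exp (-u.1)) := by
      have h4 : Real.exp R ≤ Real.exp (u.1 + v.1) * (Real.exp d * Real.exp (-u.1)) := by
        rw [← Real.exp_add, ← Real.exp_add]; exact Real.exp_le_exp.2 (by linarith)
      have h5 := h2.trans h4
      have h6 : Real.exp (u.1 + v.1) / 16 * (2 / Real.pi ^ 2 * δ ^ 2)
          = Real.exp (u.1 + v.1) * (δ ^ 2 / (8 * Real.pi ^ 2)) := by field_simp; ring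
      rw [h6] at h5
      have h7 := le_of_mul_le_mul_left h5 (Real.exp_pos _)
      rw [div_le_iff₀ (by positivity)] at h7
      linarith
    refine abs_le_of_sq_le_sq ?_ (by positivity)
    have h8 : (9 * Real.exp (d / 2) * Real.exp (-u.1 / 2)) ^ 2
        = 81 * (Real.exp d * Real.exp (-u.1)) := by
      rw [mul_pow, mul_pow, ← Real.exp_nat_mul, ← Real.exp_nat_mul]
      norm_num
      rw [mul_assoc]; congr 2 <;> ring_nf
    rw [h8]
    refine h3.trans (mul_le_mul_of_nonneg_right ?_ (by positivity))
    nlinarith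

/-- Turning towards $u$ shortens the distance. Moving inwards is harmless because the disc of radius
$R$ about $u$ is convex and contains both $v$ and the origin, the latter by $r_u\le R$; `hid` and
`hsub` express this convexity along a ray. -/
theorem hdist_le_of_cos_le {R : ℝ} {u v w : ℝ × ℝ} (hu : 0 ≤ u.1) (huR : u.1 ≤ R)
    (hw : 0 ≤ w.1) (hwv : w.1 ≤ v.1)
    (hc : Real.cos (u.2 - v.2) ≤ Real.cos (u.2 - w.2)) (h : hdist u v ≤ R) : hdist u w ≤ R := by
  have hR : 0 ≤ R := hu.trans huR
  rw [hdist_le_iff hR hu (hw.trans hwv)] at h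
  rw [hdist_le_iff hR hu hw]
  have hsu := Real.sinh_nonneg_iff.2 hu
  have hsw := Real.sinh_nonneg_iff.2 hw
  have hcu : Real.cosh u.1 ≤ Real.cosh R :=
    Real.cosh_le_cosh.2 (by rwa [abs_of_nonneg hu, abs_of_nonneg hR])
  set A := Real.cosh u.1
  set B := Real.sinh u.1 * Real.cos (u.2 - v.2) with hB
  suffices hh : A * Real.cosh w.1 - B * Real.sinh w.1 ≤ Real.cosh R by
    have := mul_nonneg (mul_nonneg hsu hsw) (sub_nonneg.2 hc)
    rw [hB] at hh
    nlinarith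
  rcases hw.eq_or_lt with h0 | h0
  · rw [← h0]; simpa using hcu
  have hsv : 0 < Real.sinh v.1 := Real.sinh_pos_iff.2 (h0.trans_le hwv)
  have hid : (A * Real.cosh w.1 - B * Real.sinh w.1) * Real.sinh v.1
      = A * Real.sinh (v.1 - w.1) + (A * Real.cosh v.1 - B * Real.sinh v.1) * Real.sinh w.1 := by
    rw [Real.sinh_sub]; ring
  have hsub : Real.sinh (v.1 - w.1) + Real.sinh w.1 ≤ Real.sinh v.1 := by
    have h1 : Real.sinh v.1 = Real.sinh (v.1 - w.1) * Real.cosh w.1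
        + Real.cosh (v.1 - w.1) * Real.sinh w.1 := by
      rw [← Real.sinh_add]; ring_nf
    have h2 := Real.sinh_nonneg_iff.2 (sub_nonneg.2 hwv)
    nlinarith [Real.one_le_cosh w.1, Real.one_le_cosh (v.1 - w.1)]
  have h2 := Real.sinh_nonneg_iff.2 (sub_nonneg.2 hwv)
  have hv' : A * Real.cosh v.1 - B * Real.sinh v.1 ≤ Real.cosh R := by
    rw [hB]; linarith
  refine le_of_mul_le_mul_right ?_ hsv
  rw [hid]
  nlinarith [mul_le_mul_of_nonneg_right hcu h2, mul_le_mul_of_nonneg_right hv' hsw,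
    mul_le_mul_of_nonneg_left hsub (Real.cosh_pos R).le]


/-! ### The law of a single node -/

theorem continuous_radialDensity (α R : ℝ) : Continuous (radialDensity α R) := by
  unfold radialDensity; fun_prop

theorem cosh_sub_one_pos {α R : ℝ} (hα : 0 < α) (hR : 0 < R) : 0 < Real.cosh (α * R) - 1 := by
  have := Real.one_lt_cosh.2 (mul_pos hα hR).ne'
  linarith

theorem radialDensity_nonneg {α R r : ℝ} (hα : 0 < α) (hR : 0 < R) (hr : 0 ≤ r) :
    0 ≤ radialDensity α R r :=
  div_nonneg (mul_nonneg hα.le (Real.sinh_nonneg_iff.2 (by positivity)))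
    (cosh_sub_one_pos hα hR).le

theorem integral_radialDensity {α R a b : ℝ} :
    ∫ r in a..b, radialDensity α R r
      = (Real.cosh (α * b) - Real.cosh (α * a)) / (Real.cosh (α * R) - 1) := by
  have h : ∀ r : ℝ, HasDerivAt (fun r => Real.cosh (α * r) / (Real.cosh (α * R) - 1))
      (radialDensity α R r) r := by
    intro r
    have h1 := ((hasDerivAt_id r).const_mul α).cosh.div_const (Real.cosh (α * R) - 1)
    refine h1.congr_deriv ?_
    simp [radialDensity, mul_comm]
  rw [intervalIntegral.integral_eq_sub_of_hasDerivAt (fun r _ => h r)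
    ((continuous_radialDensity α R).intervalIntegrable _ _)]
  ring

theorem radialLaw_Icc {α R a b : ℝ} (hα : 0 < α) (hR : 0 < R) (ha : 0 ≤ a) (hab : a ≤ b)
    (hb : b ≤ R) : radialLaw α R (Set.Icc a b)
      = ENNReal.ofReal ((Real.cosh (α * b) - Real.cosh (α * a)) / (Real.cosh (α * R) - 1)) := by
  have hsub : Set.Icc a b ∩ Set.Icc 0 R = Set.Icc a b :=
    Set.inter_eq_left.2 (Set.Icc_subset_Icc ha hb)
  rw [radialLaw, withDensity_apply _ measurableSet_Icc,
    Measure.restrict_restrict measurableSet_Icc, hsub,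
    ← ofReal_integral_eq_lintegral_ofReal, integral_Icc_eq_integral_Ioc,
    ← intervalIntegral.integral_of_le hab, integral_radialDensity]
  · exact (continuous_radialDensity α R).continuousOn.integrableOn_compact isCompact_Icc
  · filter_upwards [ae_restrict_mem measurableSet_Icc] with r hr
    exact radialDensity_nonneg hα hR (ha.trans hr.1)

theorem radialLaw_compl_Icc (α R : ℝ) : radialLaw α R (Set.Icc 0 R)ᶜ = 0 := by
  rw [radialLaw, withDensity_apply _ measurableSet_Icc.compl,
    Measure.restrict_restrict measurableSet_Icc.compl]
  simp

theorem isProbabilityMeasure_radialLaw {α R : ℝ} (hα : 0 < α) (hR : 0 < R) :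
    IsProbabilityMeasure (radialLaw α R) := by
  constructor
  rw [← measure_add_measure_compl (measurableSet_Icc (a := (0 : ℝ)) (b := R)),
    radialLaw_compl_Icc, radialLaw_Icc hα hR le_rfl hR.le le_rfl]
  simp [div_self (cosh_sub_one_pos hα hR).ne']

instance : IsProbabilityMeasure angularLaw := by
  apply cond_isProbabilityMeasure_of_finite <;>
    simp [Real.pi_pos, ENNReal.mul_eq_top]

theorem angularLaw_apply (s : Set ℝ) :
    angularLaw s = (ENNReal.ofReal (2 * Real.pi))⁻¹
      * volume (Set.Ico 0 (2 * Real.pi) ∩ s) := by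
  rw [angularLaw, cond_apply measurableSet_Ico]
  simp

theorem angularLaw_compl_Ico : angularLaw (Set.Ico 0 (2 * Real.pi))ᶜ = 0 := by
  rw [angularLaw_apply]; simp

theorem angularLaw_le {s : Set ℝ} {h : ℝ} (hs : volume s ≤ ENNReal.ofReal h) :
    angularLaw s ≤ ENNReal.ofReal (h / (2 * Real.pi)) := by
  rw [angularLaw_apply, div_eq_inv_mul,
    ENNReal.ofReal_mul (inv_nonneg.2 Real.two_pi_pos.le), ENNReal.ofReal_inv_of_pos Real.two_pi_pos]
  gcongr
  exact (measure_mono Set.inter_subset_right).trans hs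

theorem angularLaw_Ico {φ h : ℝ} (hφ : 0 ≤ φ) (hh : φ + h ≤ 2 * Real.pi) :
    angularLaw (Set.Ico φ (φ + h)) = ENNReal.ofReal (h / (2 * Real.pi)) := by
  rw [angularLaw_apply, Set.inter_eq_right.2 (Set.Ico_subset_Ico hφ hh), Real.volume_Ico,
    div_eq_inv_mul, ENNReal.ofReal_mul (inv_nonneg.2 Real.two_pi_pos.le),
    ENNReal.ofReal_inv_of_pos Real.two_pi_pos]
  ring_nf

/-- The law of the position of one node. -/
noncomputable def nodeLaw (α R : ℝ) : Measure (ℝ × ℝ) := (radialLaw α R).prod angularLaw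

theorem isProbabilityMeasure_nodeLaw {α R : ℝ} (hα : 0 < α) (hR : 0 < R) :
    IsProbabilityMeasure (nodeLaw α R) := by
  have := isProbabilityMeasure_radialLaw hα hR
  unfold nodeLaw; infer_instance

theorem nodeLaw_compl_support {α R : ℝ} (hα : 0 < α) (hR : 0 < R) :
    nodeLaw α R (Set.Icc 0 R ×ˢ Set.Ico 0 (2 * Real.pi))ᶜ = 0 := by
  have := isProbabilityMeasure_radialLaw hα hR
  rw [Set.compl_prod_eq_union]
  refine le_antisymm ((measure_union_le _ _).trans ?_) zero_le
  rw [nodeLaw, Measure.prod_prod, Measure.prod_prod, radialLaw_compl_Icc, angularLaw_compl_Ico]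
  simp

theorem le_cosh_sub_one {α R : ℝ} (hR : 4 ≤ Real.exp (α * R)) :
    Real.exp (α * R) / 4 ≤ Real.cosh (α * R) - 1 := by
  rw [Real.cosh_eq]; linarith [Real.exp_pos (-(α * R))]

/-- The increment of $\cosh(\alpha\,\cdot)$ over a unit interval is at least
$(\cosh\alpha-1)\cosh(\alpha r)$, by the addition formula. -/
theorem le_radialLaw_Icc {α R r : ℝ} (hα : 0 < α) (hr : 0 ≤ r) (hrR : r + 1 ≤ R) :
    ENNReal.ofReal ((Real.cosh α - 1) / 2 * Real.exp (-(α * (R - r))))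
      ≤ radialLaw α R (Set.Icc r (r + 1)) := by
  have hR : 0 < R := by linarith
  rw [radialLaw_Icc hα hR hr (by linarith) hrR]
  apply ENNReal.ofReal_le_ofReal
  rw [le_div_iff₀ (cosh_sub_one_pos hα hR)]
  have h1 : Real.cosh (α * R) - 1 ≤ Real.exp (α * R) := by
    rw [Real.cosh_eq]
    have : Real.exp (-(α * R)) ≤ Real.exp (α * R) :=
      Real.exp_le_exp.2 (by nlinarith [mul_pos hα hR])
    linarith
  have h2 : Real.cosh (α * r) * Real.cosh α ≤ Real.cosh (α * (r + 1)) := by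
    rw [mul_add, mul_one, Real.cosh_add]
    have := mul_nonneg (Real.sinh_nonneg_iff.2 (mul_nonneg hα.le hr))
      (Real.sinh_nonneg_iff.2 hα.le)
    linarith
  have h3 : Real.exp (α * r) / 2 ≤ Real.cosh (α * r) := by
    rw [Real.cosh_eq]; linarith [Real.exp_pos (-(α * r))]
  have h4 := Real.one_le_cosh α
  calc (Real.cosh α - 1) / 2 * Real.exp (-(α * (R - r))) * (Real.cosh (α * R) - 1)
      ≤ (Real.cosh α - 1) / 2 * Real.exp (-(α * (R - r))) * Real.exp (α * R) := by
        gcongr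
    _ = (Real.cosh α - 1) * (Real.exp (α * r) / 2) := by
        rw [mul_assoc, ← Real.exp_add]; ring_nf
    _ ≤ (Real.cosh α - 1) * Real.cosh (α * r) := by gcongr
    _ ≤ _ := by linarith

theorem le_nodeLaw_box {α R r φ h : ℝ} (hα : 0 < α) (hr : 0 ≤ r) (hrR : r + 1 ≤ R)
    (hφ : 0 ≤ φ) (hφh : φ + h ≤ 2 * Real.pi) :
    (Real.cosh α - 1) / 2 * Real.exp (-(α * (R - r))) * (h / (2 * Real.pi))
      ≤ (nodeLaw α R).real (Set.Icc r (r + 1) ×ˢ Set.Ico φ (φ + h)) := by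
  have hR : 0 < R := by linarith
  have := isProbabilityMeasure_radialLaw hα hR
  have := isProbabilityMeasure_nodeLaw hα hR
  have h4 := Real.one_le_cosh α
  rw [measureReal_def, ← ENNReal.ofReal_le_iff_le_toReal (measure_ne_top _ _), nodeLaw,
    Measure.prod_prod, angularLaw_Ico hφ hφh, ENNReal.ofReal_mul
      (mul_nonneg (by linarith) (Real.exp_pos _).le)]
  gcongr
  exact le_radialLaw_Icc hα hr hrR

theorem nodeLaw_radius_le {α R r : ℝ} (hα : 0 < α) (hR : 0 < R) (hr : 0 ≤ r) (hrR : r ≤ R)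
    (hαR : 4 ≤ Real.exp (α * R)) :
    (nodeLaw α R).real {p | p.1 ≤ r} ≤ 4 * Real.exp (-(α * (R - r))) := by
  have := isProbabilityMeasure_radialLaw hα hR
  rw [measureReal_def]
  apply ENNReal.toReal_le_of_le_ofReal (by positivity)
  have h1 : {p : ℝ × ℝ | p.1 ≤ r} = Set.Iic r ×ˢ Set.univ := by ext; simp
  have h2 : radialLaw α R (Set.Iic r) ≤ radialLaw α R (Set.Icc 0 r) := by
    have : Set.Iic r ⊆ Set.Icc 0 r ∪ (Set.Icc 0 R)ᶜ := by
      intro x hx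
      by_cases h : 0 ≤ x
      · exact Or.inl ⟨h, hx⟩
      · exact Or.inr fun h' => h h'.1
    refine (measure_mono this).trans ((measure_union_le _ _).trans ?_)
    simp [radialLaw_compl_Icc]
  rw [nodeLaw, h1, Measure.prod_prod, measure_univ, mul_one]
  refine h2.trans ?_
  rw [radialLaw_Icc hα hR le_rfl hr hrR]
  apply ENNReal.ofReal_le_ofReal
  have h3 := le_cosh_sub_one hαR
  rw [div_le_iff₀ (cosh_sub_one_pos hα hR)]
  have h4 : Real.cosh (α * r) - Real.cosh (α * 0) ≤ Real.exp (α * r) := by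
    rw [mul_zero, Real.cosh_zero, Real.cosh_eq]
    have : Real.exp (-(α * r)) ≤ Real.exp (α * r) :=
      Real.exp_le_exp.2 (by nlinarith [mul_nonneg hα.le hr])
    linarith
  calc _ ≤ Real.exp (α * r) := h4
    _ = 4 * Real.exp (-(α * (R - r))) * (Real.exp (α * R) / 4) := by
        have : Real.exp (-(α * (R - r))) * Real.exp (α * R) = Real.exp (α * r) := by
          rw [← Real.exp_add]; ring_nf
        linear_combination -this
    _ ≤ _ := by gcongr

/-- The density is at most $2\alpha e^{-\alpha(R-r)}$, so the integrand grows like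
$e^{(\alpha-1/2)r}$. As $\alpha>1/2$, the radii near $R$ dominate. -/
theorem lintegral_exp_neg_half_radialLaw {α R : ℝ} (hα : 1 / 2 < α) (hR : 0 < R)
    (hαR : 4 ≤ Real.exp (α * R)) :
    ∫⁻ r, ENNReal.ofReal (Real.exp (-r / 2)) ∂radialLaw α R
      ≤ ENNReal.ofReal (2 * α / (α - 1 / 2) * Real.exp (-R / 2)) := by
  have hα0 : 0 < α := by linarith
  have hα' : 0 < α - 1 / 2 := by linarith
  rw [radialLaw, lintegral_withDensity_eq_lintegral_mul _
    (continuous_radialDensity α R).measurable.ennreal_ofReal (by fun_prop)]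
  set g : ℝ → ℝ := fun r => 2 * α * Real.exp (-(α * R)) * Real.exp ((α - 1 / 2) * r)
  have hle : ∀ r ∈ Set.Icc 0 R, ((fun r => ENNReal.ofReal (radialDensity α R r)) *
      fun r => ENNReal.ofReal (Real.exp (-r / 2))) r ≤ ENNReal.ofReal (g r) := by
    intro r hr
    rw [Pi.mul_apply, ← ENNReal.ofReal_mul (radialDensity_nonneg hα0 hR hr.1)]
    apply ENNReal.ofReal_le_ofReal
    have h3 := le_cosh_sub_one hαR
    have h5 : Real.sinh (α * r) ≤ Real.exp (α * r) / 2 := by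
      rw [Real.sinh_eq]; linarith [Real.exp_pos (-(α * r))]
    have h4 : radialDensity α R r ≤ 2 * α * Real.exp (-(α * R)) * Real.exp (α * r) := by
      rw [radialDensity, div_le_iff₀ (cosh_sub_one_pos hα0 hR)]
      calc α * Real.sinh (α * r) ≤ α * (Real.exp (α * r) / 2) := by gcongr
        _ = 2 * α * Real.exp (-(α * R)) * Real.exp (α * r) * (Real.exp (α * R) / 4) := by
          rw [Real.exp_neg]; field_simp; norm_num
        _ ≤ _ := by gcongr
    calc _ ≤ 2 * α * Real.exp (-(α * R)) * Real.exp (α * r) * Real.exp (-r / 2) := by gcongr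
      _ = g r := by
        simp only [g]
        rw [mul_assoc _ (Real.exp (α * r)), ← Real.exp_add]; ring_nf
  refine (setLIntegral_mono (by fun_prop) hle).trans ?_
  rw [← ofReal_integral_eq_lintegral_ofReal]
  · apply ENNReal.ofReal_le_ofReal
    rw [integral_Icc_eq_integral_Ioc, ← intervalIntegral.integral_of_le hR.le]
    have hd : ∀ r : ℝ, HasDerivAt (fun r => 2 * α * Real.exp (-(α * R)) / (α - 1 / 2)
        * Real.exp ((α - 1 / 2) * r)) (g r) r := by
      intro r
      have h1 := (((hasDerivAt_id r).const_mul (α - 1 / 2)).exp).const_mul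
        (2 * α * Real.exp (-(α * R)) / (α - 1 / 2))
      refine h1.congr_deriv ?_
      simp only [g, id]
      field_simp
      exact div_self (by linarith : 0 < 2 * α - 1).ne'
    rw [intervalIntegral.integral_eq_sub_of_hasDerivAt (fun r _ => hd r)
      ((by fun_prop : Continuous g).intervalIntegrable _ _)]
    have h2 : 2 * α * Real.exp (-(α * R)) / (α - 1 / 2) * Real.exp ((α - 1 / 2) * R)
        = 2 * α / (α - 1 / 2) * Real.exp (-R / 2) := by
      rw [mul_div_right_comm, mul_assoc, ← Real.exp_add]; ring_nf
    rw [h2]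
    have : 0 ≤ 2 * α * Real.exp (-(α * R)) / (α - 1 / 2) * Real.exp ((α - 1 / 2) * 0) := by
      positivity
    linarith
  · exact (by fun_prop : Continuous g).continuousOn.integrableOn_compact isCompact_Icc
  · exact ae_of_all _ fun r => by positivity

/-- The points whose angular distance from `c` is at most `b + H e^{-r / 2}`, where `r` is their
radius. -/
def fan (c b H : ℝ) : Set (ℝ × ℝ) :=
  ⋃ k ∈ ({-1, 0, 1} : Finset ℤ),
    {p | |p.2 - c - 2 * Real.pi * k| ≤ b + H * Real.exp (-p.1 / 2)}

theorem mem_fan {c b H : ℝ} {p : ℝ × ℝ} : p ∈ fan c b H ↔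
    ∃ k ∈ ({-1, 0, 1} : Finset ℤ), |p.2 - c - 2 * Real.pi * k| ≤ b + H * Real.exp (-p.1 / 2) := by
  simp only [fan, Set.mem_iUnion, Set.mem_ofPred_eq, exists_prop]

theorem measurableSet_fan (c b H : ℝ) : MeasurableSet (fan c b H) := by
  refine Finset.measurableSet_biUnion _ fun k _ => measurableSet_le (by fun_prop) (by fun_prop)

/-- At radius $r$ the fan consists of at most three intervals of half-length $\ell=b+He^{-r/2}$, of
angular mass at most $6\ell/(2\pi)\le\ell$; this is then integrated over $r$. -/
theorem nodeLaw_fan_le {α R c b H : ℝ} (hα : 1 / 2 < α) (hR : 0 < R)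
    (hαR : 4 ≤ Real.exp (α * R)) (hb : 0 ≤ b) (hH : 0 ≤ H) :
    (nodeLaw α R).real (fan c b H) ≤ b + H * (2 * α / (α - 1 / 2)) * Real.exp (-R / 2) := by
  have hα0 : 0 < α := by linarith
  have hα' : 0 < α - 1 / 2 := by linarith
  have := isProbabilityMeasure_radialLaw hα0 hR
  rw [measureReal_def]
  apply ENNReal.toReal_le_of_le_ofReal (by positivity)
  rw [nodeLaw, Measure.prod_apply (measurableSet_fan c b H)]
  have hslice : ∀ r : ℝ, angularLaw (Prod.mk r ⁻¹' fan c b H)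
      ≤ ENNReal.ofReal b + ENNReal.ofReal H * ENNReal.ofReal (Real.exp (-r / 2)) := by
    intro r
    set ℓ := b + H * Real.exp (-r / 2)
    have hℓ : 0 ≤ ℓ := by positivity
    have hsub : Prod.mk r ⁻¹' fan c b H ⊆
        ⋃ k ∈ ({-1, 0, 1} : Finset ℤ), Metric.closedBall (c + 2 * Real.pi * k) ℓ := by
      intro φ hφ
      rw [Set.mem_preimage, mem_fan] at hφ
      obtain ⟨k, hk, h⟩ := hφ
      simp only [Set.mem_iUnion, Metric.mem_closedBall, Real.dist_eq, exists_prop]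
      exact ⟨k, hk, by rwa [← sub_sub]⟩
    have hvol : volume (⋃ k ∈ ({-1, 0, 1} : Finset ℤ),
        Metric.closedBall (c + 2 * Real.pi * k) ℓ) ≤ ENNReal.ofReal (6 * ℓ) := by
      refine (measure_biUnion_finset_le _ _).trans ?_
      simp only [Real.volume_closedBall, Finset.sum_const]
      rw [← ENNReal.ofReal_nsmul]
      apply ENNReal.ofReal_le_ofReal
      simp; linarith
    refine (measure_mono hsub).trans ((angularLaw_le hvol).trans ?_)
    rw [← ENNReal.ofReal_mul hH, ← ENNReal.ofReal_add hb (by positivity)]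
    apply ENNReal.ofReal_le_ofReal
    rw [div_le_iff₀ Real.two_pi_pos]
    nlinarith [Real.pi_gt_three]
  refine (lintegral_mono hslice).trans ?_
  rw [lintegral_add_left measurable_const, lintegral_const, measure_univ, mul_one,
    lintegral_const_mul _ (by fun_prop), ENNReal.ofReal_add hb (by positivity), mul_assoc H,
    ENNReal.ofReal_mul hH]
  gcongr
  exact lintegral_exp_neg_half_radialLaw hα hR hαR

end HyperbolicRandomGraph

/-! ### The second moment method for patterns -/

/-- The second moment method for a finite family of events. -/
theorem MeasureTheory.measureReal_iInter_compl_le_second_moment {Ω ι : Type*} [MeasurableSpace Ω]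
    [Fintype ι] {P : Measure Ω} [IsProbabilityMeasure P] {E : ι → Set Ω}
    (hE : ∀ i, MeasurableSet (E i)) (hpos : 0 < ∑ i, P.real (E i)) :
    P.real (⋂ i, (E i)ᶜ) ≤
      (∑ i, ∑ j, P.real (E i ∩ E j)) / (∑ i, P.real (E i)) ^ 2 - 1 := by
  set m := ∑ i, P.real (E i)
  set Y : Ω → ℝ := fun ω => ∑ i, (E i).indicator 1 ω
  set A := ⋂ i, (E i)ᶜ
  have hA : MeasurableSet A := MeasurableSet.iInter fun i => (hE i).compl
  have hint : ∀ S : Set Ω, MeasurableSet S → Integrable (S.indicator (1 : Ω → ℝ)) P :=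
    fun S hS => (integrable_const 1).indicator hS
  -- Chebyshev: the count $Y$ vanishes on $A$, hence $m^2P(A)\le E(Y-m)^2=EY^2-m^2$.
  have hle : ∀ ω, m ^ 2 * A.indicator 1 ω ≤ (Y ω - m) ^ 2 := by
    intro ω
    by_cases h : ω ∈ A
    · have hY : Y ω = 0 := by
        refine Finset.sum_eq_zero fun i _ => ?_
        rw [Set.indicator_of_notMem]
        exact Set.mem_iInter.1 h i
      simp [h, hY]
    · simp only [Set.indicator_of_notMem h, mul_zero]; positivity
  have hexp : ∀ ω, (Y ω - m) ^ 2
      = (∑ i, ∑ j, (E i ∩ E j).indicator 1 ω) - 2 * m * (∑ i, (E i).indicator 1 ω) + m ^ 2 := by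
    intro ω
    have : (Y ω) ^ 2 = ∑ i, ∑ j, (E i ∩ E j).indicator (1 : Ω → ℝ) ω := by
      rw [sq, Finset.sum_mul_sum]
      refine Finset.sum_congr rfl fun i _ => Finset.sum_congr rfl fun j _ => ?_
      rw [Set.inter_indicator_one, Pi.mul_apply]
    rw [← this]
    ring
  have hi1 : Integrable (fun ω => ∑ i, ∑ j, (E i ∩ E j).indicator (1 : Ω → ℝ) ω) P :=
    integrable_finsetSum _ fun i _ => integrable_finsetSum _ fun j _ =>
      hint _ ((hE i).inter (hE j))
  have hi2 : Integrable (fun ω => 2 * m * ∑ i, (E i).indicator (1 : Ω → ℝ) ω) P :=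
    (integrable_finsetSum _ fun i _ => hint _ (hE i)).const_mul _
  have hkey : m ^ 2 * P.real A ≤ (∑ i, ∑ j, P.real (E i ∩ E j)) - 2 * m * m + m ^ 2 := by
    have h1 : ∫ ω, m ^ 2 * A.indicator 1 ω ∂P = m ^ 2 * P.real A := by
      rw [integral_const_mul, integral_indicator_one hA]
    have h2a : ∫ ω, ∑ i, ∑ j, (E i ∩ E j).indicator (1 : Ω → ℝ) ω ∂P
        = ∑ i, ∑ j, P.real (E i ∩ E j) := by
      rw [integral_finsetSum]
      · refine Finset.sum_congr rfl fun i _ => ?_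
        rw [integral_finsetSum _ fun j _ => hint _ ((hE i).inter (hE j))]
        exact Finset.sum_congr rfl fun j _ => integral_indicator_one ((hE i).inter (hE j))
      · exact fun i _ => integrable_finsetSum _ fun j _ => hint _ ((hE i).inter (hE j))
    have h2b : ∫ ω, ∑ i, (E i).indicator (1 : Ω → ℝ) ω ∂P = m := by
      rw [integral_finsetSum _ fun i _ => hint _ (hE i)]
      exact Finset.sum_congr rfl fun i _ => integral_indicator_one (hE i)
    have h2 : ∫ ω, (Y ω - m) ^ 2 ∂P = (∑ i, ∑ j, P.real (E i ∩ E j)) - 2 * m * m + m ^ 2 := by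
      simp_rw [hexp]
      rw [integral_add (f := fun ω => (∑ i, ∑ j, (E i ∩ E j).indicator 1 ω)
          - 2 * m * (∑ i, (E i).indicator 1 ω)) (hi1.sub hi2) (integrable_const _),
        integral_sub hi1 hi2, integral_const_mul, h2a, h2b]
      simp
    rw [← h1, ← h2]
    refine integral_mono ((hint A hA).const_mul _) ?_ hle
    simp_rw [hexp]
    exact (hi1.sub hi2).add (integrable_const _)
  rw [le_sub_iff_add_le, le_div_iff₀ (by positivity)]
  linarith

namespace HyperbolicRandomGraph

section Pattern

variable {X ι κ : Type*}

/-- The configurations of `n` points in which the points with indices `e i` lie in the boxes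
`B i`, and all other points avoid `U`. -/
def patternEvent {n : ℕ} (B : ι → Set X) (U : Set X) (e : ι ↪ Fin n) : Set (Fin n → X) :=
  {x | (∀ i, x (e i) ∈ B i) ∧ ∀ j ∉ Set.range e, x j ∉ U}

-- As a product set, the event has a probability that factorises over the nodes.
open Classical in
theorem patternEvent_eq_pi {n : ℕ} (B : ι → Set X) (U : Set X) (e : ι ↪ Fin n) :
    patternEvent B U e = Set.univ.pi fun j =>
      if h : ∃ i, e i = j then B h.choose else Uᶜ := by
  ext x
  simp only [patternEvent, Set.mem_ofPred_eq, Set.mem_univ_pi]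
  constructor
  · rintro ⟨h1, h2⟩ j
    split_ifs with h
    · have := h1 h.choose
      rwa [h.choose_spec] at this
    · exact h2 j h
  · intro h
    refine ⟨fun i => ?_, fun j hj => ?_⟩
    · have h1 := h (e i)
      have hex : ∃ i', e i' = e i := ⟨i, rfl⟩
      rw [dif_pos hex] at h1
      rwa [e.injective hex.choose_spec] at h1
    · have h1 := h j
      have hj' : ¬ ∃ i, e i = j := hj
      rwa [dif_neg hj'] at h1

/-- The node `e i` lies in `U`, so `e'` must use it too, and disjointness of the boxes forces the
same label. Thus one site carries at most one labelled occurrence, and the variance has no cross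
terms within a site. -/
theorem patternEvent_inter_eq_empty {n : ℕ} {B : ι → Set X} {U : Set X} {e e' : ι ↪ Fin n}
    (hBU : ∀ i, B i ⊆ U) (hB : ∀ i j, i ≠ j → Disjoint (B i) (B j)) (he : e ≠ e') :
    patternEvent B U e ∩ patternEvent B U e' = ∅ := by
  by_contra h
  obtain ⟨x, hx, hx'⟩ := Set.nonempty_iff_ne_empty.2 h
  apply he
  ext i
  have h1 := hx.1 i
  have h2 : e i ∈ Set.range e' := by
    by_contra h2
    exact hx'.2 _ h2 (hBU i h1)
  obtain ⟨j, hj⟩ := h2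
  have h3 := hx'.1 j
  rw [hj] at h3
  by_cases hij : i = j
  · subst hij; rw [hj]
  · exact absurd h3 (Set.disjoint_left.1 (hB i j hij) h1)

variable [MeasurableSpace X]

theorem measurableSet_patternEvent {n : ℕ} {B : ι → Set X} {U : Set X} (e : ι ↪ Fin n)
    (hB : ∀ i, MeasurableSet (B i)) (hU : MeasurableSet U) :
    MeasurableSet (patternEvent B U e) := by
  classical
  rw [patternEvent_eq_pi]
  refine MeasurableSet.univ_pi fun j => ?_
  split_ifs
  · exact hB _
  · exact hU.compl

theorem measureReal_patternEvent [Fintype ι] {n : ℕ} (ν : Measure X) [IsProbabilityMeasure ν]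
    (B : ι → Set X) {U : Set X} (hU : MeasurableSet U) (e : ι ↪ Fin n) :
    (Measure.pi fun _ : Fin n => ν).real (patternEvent B U e)
      = (∏ i, ν.real (B i)) * (1 - ν.real U) ^ (n - Fintype.card ι) := by
  classical
  rw [patternEvent_eq_pi, measureReal_def, Measure.pi_pi, ENNReal.toReal_prod]
  rw [← Finset.prod_mul_prod_compl (Finset.univ.map e), Finset.prod_map]
  congr 1
  · refine Finset.prod_congr rfl fun i _ => ?_
    have hex : ∃ i', e i' = e i := ⟨i, rfl⟩
    rw [dif_pos hex, e.injective hex.choose_spec, measureReal_def]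
  · rw [Finset.prod_congr rfl (g := fun _ => 1 - ν.real U)]
    · rw [Finset.prod_const, Finset.card_compl, Finset.card_map, Finset.card_univ, Fintype.card_fin]
    · intro j hj
      have : ¬ ∃ i, e i = j := by simpa using hj
      rw [dif_neg this, ← measureReal_def, probReal_compl_eq_one_sub hU]

/-- If the two embeddings share a node, disjoint boxes exclude joint occurrence. Otherwise they
combine into one pattern over `ι ⊕ κ` that avoids `U ∪ U'`. -/
theorem measureReal_patternEvent_inter_le [Fintype ι] [Fintype κ] {n : ℕ} (ν : Measure X)
    [IsProbabilityMeasure ν] {B : ι → Set X} {B' : κ → Set X} {U U' : Set X}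
    (hU : MeasurableSet U) (hU' : MeasurableSet U') (hBB' : ∀ i j, Disjoint (B i) (B' j))
    (e : ι ↪ Fin n) (e' : κ ↪ Fin n) :
    (Measure.pi fun _ : Fin n => ν).real (patternEvent B U e ∩ patternEvent B' U' e')
      ≤ (∏ i, ν.real (B i)) * (∏ i, ν.real (B' i))
        * (1 - ν.real (U ∪ U')) ^ (n - (Fintype.card ι + Fintype.card κ)) := by
  have hq : 0 ≤ 1 - ν.real (U ∪ U') := sub_nonneg.2 measureReal_le_one
  by_cases hd : ∀ i j, e i ≠ e' j
  · let f : ι ⊕ κ ↪ Fin n := ⟨Sum.elim e e', Function.Injective.sumElim e.injective e'.injective hd⟩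
    have hsub : patternEvent B U e ∩ patternEvent B' U' e'
        ⊆ patternEvent (Sum.elim B B') (U ∪ U') f := by
      rintro x ⟨⟨h1, h2⟩, h3, h4⟩
      refine ⟨?_, fun j hj => ?_⟩
      · rintro (i | i)
        · exact h1 i
        · exact h3 i
      · rintro (h | h)
        · exact h2 j (fun ⟨i, hi⟩ => hj ⟨Sum.inl i, hi⟩) h
        · exact h4 j (fun ⟨i, hi⟩ => hj ⟨Sum.inr i, hi⟩) h
    refine (measureReal_mono hsub).trans (le_of_eq ?_)
    rw [measureReal_patternEvent ν _ (hU.union hU') f, Fintype.prod_sum_type, Fintype.card_sum]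
    simp
  · push Not at hd
    obtain ⟨i, j, hij⟩ := hd
    have : patternEvent B U e ∩ patternEvent B' U' e' = ∅ := by
      by_contra h
      obtain ⟨x, hx, hx'⟩ := Set.nonempty_iff_ne_empty.2 h
      have h1 := hx.1 i
      have h2 := hx'.1 j
      rw [← hij] at h2
      exact Set.disjoint_left.1 (hBB' i j) h1 h2
    rw [this, measureReal_empty]
    have : ∀ i, 0 ≤ ν.real (B i) := fun _ => measureReal_nonneg
    positivity

/-- With high probability one of the patterns `(B s, U s)` occurs. -/
theorem measureReal_no_pattern_le {S : Type*} [Fintype S] [Fintype ι] {n : ℕ} (ν : Measure X)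
    [IsProbabilityMeasure ν] {B : S → ι → Set X} {U : S → Set X}
    (hBm : ∀ s i, MeasurableSet (B s i)) (hUm : ∀ s, MeasurableSet (U s))
    (hBU : ∀ s i, B s i ⊆ U s) (hB : ∀ s i j, i ≠ j → Disjoint (B s i) (B s j))
    (hBB : ∀ s s', s ≠ s' → ∀ i j, Disjoint (B s i) (B s' j)) {ρ m : ℝ} (hm : 0 < m)
    (hρ : ∀ s s', s ≠ s' → (1 - ν.real (U s ∪ U s')) ^ (n - (Fintype.card ι + Fintype.card ι))
      ≤ ρ * ((1 - ν.real (U s)) ^ (n - Fintype.card ι)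
          * (1 - ν.real (U s')) ^ (n - Fintype.card ι)))
    (hρ0 : 0 ≤ ρ)
    (hmean : m ≤ ∑ s, (n.descFactorial (Fintype.card ι) : ℝ) * (∏ i, ν.real (B s i))
      * (1 - ν.real (U s)) ^ (n - Fintype.card ι)) :
    (Measure.pi fun _ : Fin n => ν).real
      {x | ∀ s, ∀ e : ι ↪ Fin n, x ∉ patternEvent (B s) (U s) e} ≤ 1 / m + ρ - 1 := by
  classical
  set P := Measure.pi fun _ : Fin n => ν
  let E : S × (ι ↪ Fin n) → Set (Fin n → X) := fun τ => patternEvent (B τ.1) (U τ.1) τ.2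
  have hE : ∀ τ, MeasurableSet (E τ) := fun τ =>
    measurableSet_patternEvent _ (hBm _) (hUm _)
  let p : S → ℝ := fun s => (∏ i, ν.real (B s i)) * (1 - ν.real (U s)) ^ (n - Fintype.card ι)
  have hPE : ∀ τ, P.real (E τ) = p τ.1 := fun τ => measureReal_patternEvent ν _ (hUm _) _
  have hsum : ∑ τ, P.real (E τ) = ∑ s, (n.descFactorial (Fintype.card ι) : ℝ)
      * (∏ i, ν.real (B s i)) * (1 - ν.real (U s)) ^ (n - Fintype.card ι) := by
    simp_rw [hPE, Fintype.sum_prod_type]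
    refine Finset.sum_congr rfl fun s _ => ?_
    rw [Finset.sum_const, Finset.card_univ, Fintype.card_embedding_eq, Fintype.card_fin,
      nsmul_eq_mul]
    simp only [p]; ring
  rw [← hsum] at hmean
  set μ := ∑ τ, P.real (E τ) with hμ
  have hμ0 : 0 < μ := hm.trans_le hmean
  have hset : {x | ∀ s, ∀ e : ι ↪ Fin n, x ∉ patternEvent (B s) (U s) e} = ⋂ τ, (E τ)ᶜ := by
    ext x
    simp [E]
  rw [hset]
  refine (measureReal_iInter_compl_le_second_moment hE hμ0).trans ?_
  -- Diagonal pairs contribute $\mu$, distinct embeddings at one site nothing, and different sites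
  -- at most $\rho$ times the independent value, so $EY^2\le\mu+\rho\mu^2$.
  have hpair : ∀ τ τ', P.real (E τ ∩ E τ') ≤
      (if τ = τ' then P.real (E τ) else 0) + ρ * (P.real (E τ) * P.real (E τ')) := by
    rintro ⟨s, e⟩ ⟨s', e'⟩
    have hnn : 0 ≤ ρ * (P.real (E (s, e)) * P.real (E (s', e'))) := by positivity
    by_cases hs : s = s'
    · subst hs
      by_cases he : e = e'
      · subst he
        rw [if_pos rfl, Set.inter_self]
        linarith
      · have : E (s, e) ∩ E (s, e') = ∅ := patternEvent_inter_eq_empty (hBU s) (hB s) he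
        rw [this, measureReal_empty]
        have : 0 ≤ (if (s, e) = (s, e') then P.real (E (s, e)) else 0) := by
          split_ifs <;> positivity
        linarith
    · rw [if_neg (fun h => hs (congrArg Prod.fst h)), zero_add, hPE, hPE]
      refine (measureReal_patternEvent_inter_le ν (hUm s) (hUm s') (hBB s s' hs) e e').trans ?_
      have h1 := hρ s s' hs
      have h2 : 0 ≤ (∏ i, ν.real (B s i)) * (∏ i, ν.real (B s' i)) :=
        mul_nonneg (Finset.prod_nonneg fun _ _ => measureReal_nonneg)
          (Finset.prod_nonneg fun _ _ => measureReal_nonneg)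
      refine (mul_le_mul_of_nonneg_left h1 h2).trans (le_of_eq ?_)
      simp only [p]; ring
  have htot : ∑ τ, ∑ τ', P.real (E τ ∩ E τ') ≤ μ + ρ * μ ^ 2 := by
    refine (Finset.sum_le_sum fun τ _ => Finset.sum_le_sum fun τ' _ => hpair τ τ').trans
      (le_of_eq ?_)
    simp_rw [Finset.sum_add_distrib, ← Finset.mul_sum]
    rw [← Finset.sum_mul, ← hμ]
    simp [hμ, sq]
  have h3 : (∑ τ, ∑ τ', P.real (E τ ∩ E τ')) / μ ^ 2 ≤ 1 / μ + ρ := by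
    rw [div_le_iff₀ (by positivity)]
    refine htot.trans (le_of_eq ?_)
    field_simp
  have h4 : 1 / μ ≤ 1 / m := one_div_le_one_div_of_le hm hmean
  linarith

end Pattern

end HyperbolicRandomGraph

/-! ### Deep nodes belong to the giant component -/

theorem SimpleGraph.Reachable.of_adj_imp {V : Type*} {G : SimpleGraph V} {Q : V → Prop}
    (hQ : ∀ a b, G.Adj a b → Q a → Q b) {u v : V} (h : G.Reachable u v) (hu : Q u) : Q v := by
  obtain ⟨p⟩ := h
  induction p with
  | nil => exact hu
  | cons hadj _ ih => exact ih (hQ _ _ hadj hu)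

namespace HyperbolicRandomGraph

/-- Pairs of points whose angular coordinates are close on the circle, up to a few multiples of
`ω`. -/
def closePairs (ω : ℝ) : Set ((ℝ × ℝ) × (ℝ × ℝ)) :=
  {p | p.1.2 ∈ Set.Ico 0 (2 * Real.pi) ∧ p.2.2 ∈ Set.Ico 0 (2 * Real.pi) ∧
    (|p.1.2 - p.2.2| ≤ 3 * ω ∨ 2 * Real.pi - 2 * ω ≤ |p.1.2 - p.2.2|)}

/-- Edges of a component without nodes of radius at most `ρ` do not pass over such nodes. -/
theorem mem_Icc_angle_of_reachable {n : ℕ} {R ρ : ℝ} {x : Fin n → ℝ × ℝ}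
    (hx : ∀ v, x v ∈ Set.Icc 0 R ×ˢ Set.Ico 0 (2 * Real.pi))
    {K : (graph R x).ConnectedComponent} (hK : ∀ v ∈ K.supp, ρ < (x v).1)
    {w w' : Fin n} (hw : (x w).1 ≤ ρ) (hw' : (x w').1 ≤ ρ) {u v : Fin n} (hu : u ∈ K.supp)
    (hv : v ∈ K.supp) (huw : (x u).2 ∈ Set.Icc (x w).2 (x w').2) :
    (x v).2 ∈ Set.Icc (x w).2 (x w').2 := by
  -- If `z` were angularly at least as close to `a` as `b` is, then `a` would be adjacent to `z`,
  -- and `z` would lie in `K`.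
  have hcross : ∀ a ∈ K.supp, ∀ b ∈ K.supp, (graph R x).Adj a b → ∀ z, (x z).1 ≤ ρ →
      Real.cos ((x a).2 - (x z).2) < Real.cos ((x a).2 - (x b).2) := by
    intro a ha b hb hab z hz
    by_contra! hc
    have hd : hdist (x a) (x z) ≤ R :=
      hdist_le_of_cos_le (hx a).1.1 (hx a).1.2 (hx z).1.1 (hz.trans (hK b hb).le) hc hab.2
    have hne : a ≠ z := by
      rintro rfl
      exact absurd (hK a ha) (not_lt.2 hz)
    have hadj : (graph R x).Adj a z := ⟨hne, hd⟩
    have hzK : z ∈ K.supp := by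
      rw [SimpleGraph.ConnectedComponent.mem_supp_iff] at ha ⊢
      rw [← ha]
      exact (SimpleGraph.ConnectedComponent.sound hadj.reachable).symm
    exact absurd (hK z hzK) (not_lt.2 hz)
  have hreach : (graph R x).Reachable u v := by
    rw [SimpleGraph.ConnectedComponent.mem_supp_iff] at hu hv
    exact SimpleGraph.ConnectedComponent.exact (hu.trans hv.symm)
  refine (hreach.of_adj_imp (Q := fun a => a ∈ K.supp ∧ (x a).2 ∈ Set.Icc (x w).2 (x w').2)
    ?_ ⟨hu, huw⟩).2
  rintro a b hab ⟨ha, ha1, ha2⟩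
  have hb : b ∈ K.supp := by
    rw [SimpleGraph.ConnectedComponent.mem_supp_iff] at ha ⊢
    rw [← ha]
    exact (SimpleGraph.ConnectedComponent.sound hab.reachable).symm
  have c1 := hcross a ha b hb hab w hw
  have c2 := hcross a ha b hb hab w' hw'
  obtain ⟨-, ha0, haπ⟩ := hx a
  obtain ⟨-, hb0, hbπ⟩ := hx b
  obtain ⟨-, hw0, hwπ⟩ := hx w
  obtain ⟨-, hw0', hwπ'⟩ := hx w'
  refine ⟨hb, ?_, ?_⟩
  -- An edge that leaves the arc downwards passes over `w` if its angle is at most `π`; otherwise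
  -- its short side runs the other way round the circle and passes over `w'`. Leaving upwards is
  -- symmetric.
  · by_contra! hlt
    rcases le_total ((x a).2 - (x b).2) Real.pi with h | h
    · exact absurd c1 (not_lt.2 (Real.cos_le_cos_of_nonneg_of_le_pi (by linarith) h (by linarith)))
    · rw [← Real.cos_neg, ← Real.cos_two_pi_sub ((x a).2 - (x b).2)] at c2
      exact absurd c2 (not_lt.2 (Real.cos_le_cos_of_nonneg_of_le_pi (by linarith)
        (by linarith) (by linarith)))
  · by_contra! hlt
    rcases le_total ((x b).2 - (x a).2) Real.pi with h | h
    · rw [← Real.cos_neg, ← Real.cos_neg ((x a).2 - (x b).2)] at c2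
      exact absurd c2 (not_lt.2 (Real.cos_le_cos_of_nonneg_of_le_pi (by linarith) (by linarith)
        (by linarith)))
    · rw [← Real.cos_neg ((x a).2 - (x b).2), ← Real.cos_two_pi_sub (-((x a).2 - (x b).2))] at c1
      exact absurd c1 (not_lt.2 (Real.cos_le_cos_of_nonneg_of_le_pi (by linarith)
        (by linarith) (by linarith)))

-- All deep nodes lie in one component `K₀`, because those in the same or neighbouring sectors are
-- adjacent; one per sector gives `K₀` at least `N` nodes. A different component has no deep node,
-- so all its pairs are close; it then has fewer than `N` nodes and is not giant.
open Classical in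
theorem mem_giant_of_radius_le {n N : ℕ} {R t ω : ℝ} {x : Fin n → ℝ × ℝ}
    (hR : 0 ≤ R) (ht : 4 ≤ Real.exp t) (hN : 0 < N) (hω : N * ω = 2 * Real.pi)
    (hωt : 2 * ω ≤ Real.exp (t - R / 2))
    (hx : ∀ v, x v ∈ Set.Icc 0 R ×ˢ Set.Ico 0 (2 * Real.pi))
    (hsec : ∀ j < N, ∃ v, (x v).1 ≤ R - t ∧ (x v).2 ∈ Set.Ico (j * ω) (j * ω + ω))
    (hpairs : (Finset.univ.filter fun p : Fin n × Fin n =>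
      (x p.1, x p.2) ∈ closePairs ω).card < N ^ 2)
    {K : (graph R x).ConnectedComponent} (hK : IsGiant K) {v : Fin n}
    (hv : (x v).1 ≤ R - t) : v ∈ K.supp := by
  have hN' : (0 : ℝ) < N := by exact_mod_cast hN
  have hω0 : 0 < ω := by
    by_contra! h
    nlinarith [Real.pi_pos]
  have hdeep : ∀ u v, (x u).1 ≤ R - t → (x v).1 ≤ R - t →
      |(x u).2 - (x v).2| ≤ 2 * ω → (graph R x).Reachable u v := by
    intro u v hu hv huv
    by_cases hne : u = v
    · rw [hne]
    refine SimpleGraph.Adj.reachable ⟨hne, hdist_le_of_angle hR (hx u).1.1 (hx v).1.1 ?_ ?_⟩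
    · have h1 : |(x u).1 - (x v).1| ≤ R - t :=
        abs_le.2 ⟨by linarith [(hx u).1.1], by linarith [(hx v).1.1]⟩
      rw [← Real.cosh_abs]
      have h2 : Real.cosh |(x u).1 - (x v).1| ≤ Real.exp |(x u).1 - (x v).1| := by
        rw [Real.cosh_eq]
        have : Real.exp (-|(x u).1 - (x v).1|) ≤ Real.exp |(x u).1 - (x v).1| :=
          Real.exp_le_exp.2 (by linarith [abs_nonneg ((x u).1 - (x v).1)])
        linarith
      refine (h2.trans (Real.exp_le_exp.2 h1)).trans ?_
      rw [Real.exp_sub]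
      exact div_le_div_of_nonneg_left (Real.exp_pos R).le (by norm_num) ht
    · have h1 : ((x u).2 - (x v).2) ^ 2 ≤ Real.exp (t - R / 2) ^ 2 :=
        sq_le_sq' (by linarith [(abs_le.1 huv).1]) (by linarith [(abs_le.1 huv).2])
      have h2 : Real.exp ((x u).1 + (x v).1) ≤ Real.exp (2 * (R - t)) :=
        Real.exp_le_exp.2 (by linarith)
      calc _ ≤ Real.exp (2 * (R - t)) * Real.exp (t - R / 2) ^ 2 := by gcongr
        _ = Real.exp R := by rw [← Real.exp_nat_mul, ← Real.exp_add]; congr 1; push_cast; ring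
        _ ≤ _ := by linarith [Real.exp_pos R]
  have hfloor : ∀ u, ∃ j < N, (x u).2 ∈ Set.Ico (j * ω) (j * ω + ω) := by
    intro u
    obtain ⟨-, h0, hπ⟩ := hx u
    refine ⟨⌊(x u).2 / ω⌋₊, ?_, ?_, ?_⟩
    · rw [Nat.floor_lt (by positivity), div_lt_iff₀ hω0]; linarith
    · rw [← le_div_iff₀ hω0]; exact Nat.floor_le (by positivity)
    · have := Nat.lt_floor_add_one ((x u).2 / ω)
      rw [div_lt_iff₀ hω0] at this
      linarith
  have : Nonempty (Fin n) := ⟨v⟩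
  choose! w hw1 hw2 using hsec
  have hchain : ∀ j < N, (graph R x).Reachable (w 0) (w j) := by
    intro j
    induction j with
    | zero => intro _; rfl
    | succ j ih =>
      intro hj
      refine (ih (by omega)).trans (hdeep _ _ (hw1 _ (by omega)) (hw1 _ hj) ?_)
      have h1 := hw2 j (by omega)
      have h2 := hw2 (j + 1) hj
      push_cast at h2
      exact abs_le.2 ⟨by linarith [h1.1, h2.2], by linarith [h1.2, h2.1]⟩
  have hall : ∀ u, (x u).1 ≤ R - t → (graph R x).Reachable (w 0) u := by
    intro u hu
    obtain ⟨j, hj, hj'⟩ := hfloor u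
    refine (hchain j hj).trans (hdeep _ _ (hw1 j hj) hu ?_)
    have h1 := hw2 j hj
    exact abs_le.2 ⟨by linarith [h1.1, hj'.2], by linarith [h1.2, hj'.1]⟩
  set K₀ := (graph R x).connectedComponentMk (w 0)
  have hmem : ∀ u, (x u).1 ≤ R - t → u ∈ K₀.supp := fun u hu =>
    (SimpleGraph.ConnectedComponent.sound (hall u hu)).symm
  have hcard₀ : N ≤ K₀.supp.ncard := by
    have h1 : (Set.range fun j : Fin N => w j) ⊆ K₀.supp := by
      rintro _ ⟨j, rfl⟩
      exact hmem _ (hw1 j j.2)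
    have h2 : Function.Injective fun j : Fin N => w j := by
      have key : ∀ i j : Fin N, i < j → w i ≠ w j := by
        intro i j hij heq
        have h1 := hw2 i i.2
        have h2 := hw2 j j.2
        rw [heq] at h1
        have : ((i : ℕ) : ℝ) + 1 ≤ (j : ℕ) := by exact_mod_cast hij
        nlinarith [h1.2, h2.1]
      intro i j hij
      rcases lt_trichotomy i j with h | h | h
      · exact absurd hij (key i j h)
      · exact h
      · exact absurd hij.symm (key j i h)
    calc N = (Set.range fun j : Fin N => w j).ncard := by
          rw [← Set.image_univ, Set.ncard_image_of_injective _ h2, Set.ncard_univ]; simp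
      _ ≤ _ := Set.ncard_le_ncard h1
  suffices hKK : K = K₀ by rw [hKK]; exact hmem v hv
  by_contra hne
  have hshallow : ∀ u ∈ K.supp, R - t < (x u).1 := by
    intro u hu
    by_contra! h
    exact hne (((SimpleGraph.ConnectedComponent.mem_supp_iff _ _).1 hu).symm.trans
      ((SimpleGraph.ConnectedComponent.mem_supp_iff _ _).1 (hmem u h)))
  -- A node in an inner sector sits between deep nodes of the two neighbouring sectors, which
  -- confine `K` to three sectors. The first and last sectors are excluded since they have no
  -- neighbour without wrapping around.
  have hmid : ∀ u ∈ K.supp, ∀ v ∈ K.supp, (x u).2 ∈ Set.Ico ω (2 * Real.pi - ω) →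
      |(x u).2 - (x v).2| ≤ 3 * ω := by
    intro u hu v hv huω
    obtain ⟨j, hj, hj1, hj2⟩ := hfloor u
    have hj0 : 0 < j := by
      rw [Nat.pos_iff_ne_zero]; rintro rfl
      simp only [Nat.cast_zero, zero_mul, zero_add] at hj2
      linarith [huω.1]
    obtain ⟨i, rfl⟩ : ∃ i, j = i + 1 := ⟨j - 1, by omega⟩
    have hjN : i + 2 < N := by
      have : ((i + 2 : ℕ) : ℝ) < N := by
        push_cast at hj1 ⊢
        nlinarith [huω.2]
      exact_mod_cast this
    have h1 := hw2 i (by omega)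
    have h2 := hw2 (i + 2) hjN
    push_cast at h1 h2 hj1 hj2
    have hin : (x u).2 ∈ Set.Icc (x (w i)).2 (x (w (i + 2))).2 :=
      ⟨by linarith [h1.2], by linarith [h2.1]⟩
    have := mem_Icc_angle_of_reachable hx hshallow (hw1 i (by omega)) (hw1 _ hjN) hu hv hin
    exact abs_le.2 ⟨by linarith [this.2, h2.2], by linarith [this.1, h1.1]⟩
  -- If neither node is in an inner sector, both are near the cut at angle zero, either on the same
  -- side or on opposite sides; the latter is the second alternative of `closePairs`.
  have hclose : ∀ u ∈ K.supp, ∀ v ∈ K.supp, (x u, x v) ∈ closePairs ω := by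
    intro u hu v hv
    refine ⟨(hx u).2, (hx v).2, ?_⟩
    by_cases h1 : (x u).2 ∈ Set.Ico ω (2 * Real.pi - ω)
    · exact Or.inl (hmid u hu v hv h1)
    by_cases h2 : (x v).2 ∈ Set.Ico ω (2 * Real.pi - ω)
    · left; rw [abs_sub_comm]; exact hmid v hv u hu h2
    obtain ⟨hu0, huπ⟩ := (hx u).2
    obtain ⟨hv0, hvπ⟩ := (hx v).2
    simp only [Set.mem_Ico, not_and_or, not_le, not_lt] at h1 h2
    dsimp only
    rcases h1 with h1 | h1 <;> rcases h2 with h2 | h2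
    · left; exact abs_le.2 ⟨by linarith, by linarith⟩
    · right; rw [abs_sub_comm]; exact le_trans (by linarith) (le_abs_self _)
    · right; exact le_trans (by linarith) (le_abs_self _)
    · left; exact abs_le.2 ⟨by linarith, by linarith⟩
  have hcardK : K.supp.ncard ^ 2 < N ^ 2 := by
    refine lt_of_le_of_lt ?_ hpairs
    rw [Set.ncard_eq_toFinset_card', sq, ← Finset.card_product]
    refine Finset.card_le_card fun p hp => ?_
    rw [Finset.mem_product, Set.mem_toFinset, Set.mem_toFinset] at hp
    simpa using hclose _ hp.1 _ hp.2
  have := lt_of_pow_lt_pow_left₀ 2 (Nat.zero_le N) hcardK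
  have := hK K₀
  omega

end HyperbolicRandomGraph

/-! ### A dangling path forces a large diameter -/

theorem SimpleGraph.abs_sub_le_mul_dist {V : Type*} {G : SimpleGraph V} (hG : G.Connected)
    {f : V → ℝ} {D : ℝ} (hf : ∀ a b, G.Adj a b → |f a - f b| ≤ D) (u v : V) :
    |f u - f v| ≤ D * G.dist u v := by
  obtain ⟨p, hp⟩ := hG.exists_walk_length_eq_dist u v
  rw [← hp]
  clear hp
  induction p with
  | nil => simp
  | cons hadj _ ih =>
    rw [SimpleGraph.Walk.length_cons]
    push_cast
    have h1 := hf _ _ hadj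
    have h2 := abs_sub_le (f _) (f _) (f _) |>.trans (add_le_add h1 ih)
    linarith

namespace HyperbolicRandomGraph

/-- The inner radius of the boxes of a pattern: a path of `L` boxes near the boundary, one box
close to the boundary, and one box at depth `t`. -/
noncomputable def boxRadius (R t : ℝ) {L : ℕ} : Option (Option (Fin L)) → ℝ
  | none => R - t - 1
  | some none => R - 8
  | some (some _) => R - 1

/-- The angular offset of the boxes of a pattern. -/
noncomputable def boxAngle (R t : ℝ) {L : ℕ} : Option (Option (Fin L)) → ℝ
  | none => L * (Real.exp (-R / 2) / 2) + 28 * Real.exp (t / 2) * Real.exp (-R / 2)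
  | some none => L * (Real.exp (-R / 2) / 2)
  | some (some i) => i * (Real.exp (-R / 2) / 2)

/-- The boxes of the pattern at angle `c`. -/
def pathBox (R t c : ℝ) {L : ℕ} (i : Option (Option (Fin L))) : Set (ℝ × ℝ) :=
  Set.Icc (boxRadius R t i) (boxRadius R t i + 1) ×ˢ
    Set.Ico (c + boxAngle R t i) (c + boxAngle R t i + Real.exp (-R / 2) / 2)

/-- The region in which no nodes besides those of the pattern are allowed. -/
def pathFan (R c : ℝ) (L : ℕ) : Set (ℝ × ℝ) := fan c (L * Real.exp (-R / 2)) 30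

theorem measurableSet_pathBox (R t c : ℝ) {L : ℕ} (i : Option (Option (Fin L))) :
    MeasurableSet (pathBox R t c i) := measurableSet_Icc.prod measurableSet_Ico

theorem boxAngle_nonneg (R t : ℝ) {L : ℕ} (i : Option (Option (Fin L))) :
    0 ≤ boxAngle R t i := by
  rcases i with _ | _ | i <;> simp only [boxAngle] <;> positivity

theorem boxAngle_le (R t : ℝ) {L : ℕ} (i : Option (Option (Fin L))) :
    boxAngle R t i ≤ L * (Real.exp (-R / 2) / 2) + 28 * Real.exp (t / 2) * Real.exp (-R / 2) := by
  have h : 0 < 28 * Real.exp (t / 2) * Real.exp (-R / 2) := by positivity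
  rcases i with _ | _ | i <;> simp only [boxAngle]
  · exact le_rfl
  · linarith
  · have : ((i : ℕ) : ℝ) ≤ L := by exact_mod_cast i.2.le
    nlinarith [Real.exp_pos (-R / 2)]

/-- The deep box is the critical one: there $r\le R-t$, so its offset $28e^{t/2}e^{-R/2}$ is at most
$28e^{-r/2}$, within the fan's $30e^{-r/2}$. -/
theorem pathBox_subset_pathFan {R t c : ℝ} {L : ℕ} (hL : 1 ≤ L) (i : Option (Option (Fin L))) :
    pathBox R t c i ⊆ pathFan R c L := by
  rintro ⟨r, φ⟩ ⟨⟨hr1, hr2⟩, hφ1, hφ2⟩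
  have ha := Real.exp_pos (-R / 2)
  have hL' : (1 : ℝ) ≤ L := by exact_mod_cast hL
  rw [pathFan, mem_fan]
  refine ⟨0, by simp, ?_⟩
  have hb := boxAngle_nonneg R t i
  dsimp only at hr1 hr2 hφ1 hφ2 ⊢
  rw [Int.cast_zero, mul_zero, sub_zero, abs_of_nonneg (by linarith)]
  rcases i with _ | _ | i <;> simp only [boxAngle, boxRadius] at hr1 hr2 hφ1 hφ2
  · have h1 : Real.exp (t / 2) * Real.exp (-R / 2) ≤ Real.exp (-r / 2) := by
      rw [← Real.exp_add]; exact Real.exp_le_exp.2 (by linarith)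
    nlinarith [mul_pos (Real.exp_pos (t / 2)) ha]
  · nlinarith [Real.exp_pos (-r / 2)]
  · have h1 : ((i : ℕ) : ℝ) + 1 ≤ L := by exact_mod_cast i.2
    nlinarith [Real.exp_pos (-r / 2)]

theorem disjoint_pathBox {R t c : ℝ} {L : ℕ} (ht : 0 ≤ t) {i j : Option (Option (Fin L))}
    (hij : i ≠ j) : Disjoint (pathBox R t c i) (pathBox R t c j) := by
  have ha := Real.exp_pos (-R / 2)
  have het : 1 ≤ Real.exp (t / 2) := Real.one_le_exp (by linarith)
  have hw : Real.exp (-R / 2) / 2 ≤ 28 * Real.exp (t / 2) * Real.exp (-R / 2) := by nlinarith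
  have key : ∀ i j : Option (Option (Fin L)),
      boxAngle R t i + Real.exp (-R / 2) / 2 ≤ boxAngle R t j →
      Disjoint (pathBox R t c i) (pathBox R t c j) := by
    intro i j h
    rw [Set.disjoint_left]
    rintro p ⟨-, h1⟩ ⟨-, h2⟩
    exact absurd (h1.2.trans_le (by linarith)) (not_lt.2 h2.1)
  have hfin : ∀ i : Fin L, (i : ℝ) * (Real.exp (-R / 2) / 2) + Real.exp (-R / 2) / 2
      ≤ L * (Real.exp (-R / 2) / 2) := by
    intro i
    have h1 : ((i : ℕ) : ℝ) + 1 ≤ L := by exact_mod_cast i.2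
    nlinarith
  have hlt : ∀ i j : Fin L, i < j → (i : ℝ) * (Real.exp (-R / 2) / 2) + Real.exp (-R / 2) / 2
      ≤ j * (Real.exp (-R / 2) / 2) := by
    intro i j hij
    have h1 : ((i : ℕ) : ℝ) + 1 ≤ (j : ℕ) := by exact_mod_cast hij
    nlinarith
  rcases i with _ | _ | i <;> rcases j with _ | _ | j
  · exact absurd rfl hij
  · exact (key _ _ (by simp only [boxAngle]; linarith)).symm
  · exact (key _ _ (by simp only [boxAngle]; linarith [hfin j])).symm
  · exact key _ _ (by simp only [boxAngle]; linarith)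
  · exact absurd rfl hij
  · exact (key _ _ (by simp only [boxAngle]; linarith [hfin j])).symm
  · exact key _ _ (by simp only [boxAngle]; linarith [hfin i])
  · exact key _ _ (by simp only [boxAngle]; linarith [hfin i])
  · rcases lt_trichotomy i j with h | h | h
    · exact key _ _ (hlt i j h)
    · exact absurd (by rw [h]) hij
    · exact (key (some (some j)) (some (some i)) (hlt j i h)).symm

-- The function `f` is the angle relative to `c` on the path and constant off it. Edges that avoid
-- the path do not change `f`; the others join path nodes to each other or to the hook `q` and
-- change it by at most `812 * a`. Between the first path node and `q` it grows by at least `(L - 1)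
-- * a / 2`.
set_option maxHeartbeats 1600000 in
theorem sub_one_le_mul_diam_of_pattern {n L : ℕ} {R t c : ℝ} {x : Fin n → ℝ × ℝ}
    (ht : 0 ≤ t) (hL : 1 ≤ L) (hRt : t + 10 ≤ R)
    (hsmall : (L + 1) * Real.exp (-R / 2) + 1000 * Real.exp (t / 2) * Real.exp (-R / 2) ≤ 1)
    (hx : ∀ v, x v ∈ Set.Icc 0 R ×ˢ Set.Ico 0 (2 * Real.pi))
    (e : Option (Option (Fin L)) ↪ Fin n)
    (hpat : x ∈ patternEvent (pathBox R t c) (pathFan R c L) e)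
    {K : (graph R x).ConnectedComponent} (hK : ∀ v, (x v).1 ≤ R - t → v ∈ K.supp) :
    (L : ℝ) - 1 ≤ 1624 * K.toSimpleGraph.diam := by
  obtain ⟨hbox, hfan⟩ := hpat
  have hR0 : 0 ≤ R := by linarith
  set a := Real.exp (-R / 2) with ha_def
  have ha : 0 < a := Real.exp_pos _
  set T := Real.exp (t / 2) with hT_def
  have hT : 1 ≤ T := Real.one_le_exp (by linarith)
  have hTa : a ≤ T * a := by nlinarith
  have hL' : (1 : ℝ) ≤ L := by exact_mod_cast hL
  have hpi := Real.pi_gt_three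
  have haa : a ^ 2 = Real.exp (-R) := by rw [ha_def, ← Real.exp_nat_mul]; congr 1; push_cast; ring
  have hTT : T ^ 2 = Real.exp t := by rw [hT_def, ← Real.exp_nat_mul]; congr 1; push_cast; ring
  -- the coordinates of the nodes of the pattern
  obtain ⟨⟨hwr1, hwr2⟩, hwφ1, hwφ2⟩ := hbox none
  obtain ⟨⟨hqr1, hqr2⟩, hqφ1, hqφ2⟩ := hbox (some none)
  have hp := fun i => hbox (some (some i))
  set w := e none
  set q := e (some none)
  set p : Fin L → Fin n := fun i => e (some (some i))
  simp only [boxRadius, boxAngle, ← ha_def, ← hT_def] at hwr1 hwr2 hwφ1 hwφ2 hqr1 hqr2 hqφ1 hqφ2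
  have hpr1 : ∀ i, R - 1 ≤ (x (p i)).1 := fun i => (hp i).1.1
  have hpφ1 : ∀ i, c + i * (a / 2) ≤ (x (p i)).2 := fun i => (hp i).2.1
  have hpφ2 : ∀ i, (x (p i)).2 < c + i * (a / 2) + a / 2 := fun i => (hp i).2.2
  have hpφ3 : ∀ i, c ≤ (x (p i)).2 := fun i => le_trans (by
    have : 0 ≤ (i : ℝ) * (a / 2) := by positivity
    linarith) (hpφ1 i)
  have hpφ4 : ∀ i, (x (p i)).2 < c + L * (a / 2) := fun i => (hpφ2 i).trans_le (by
    have h1 : ((i : ℕ) : ℝ) + 1 ≤ L := by exact_mod_cast i.2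
    nlinarith)
  -- neighbours of path nodes
  have hexp_half : Real.exp (1 / 2) ≤ 1.65 := by
    have h1 : Real.exp (1 / 2) ^ 2 = Real.exp 1 := by
      rw [← Real.exp_nat_mul]; norm_num
    have := Real.exp_one_lt_d9
    nlinarith [Real.exp_pos (1 / 2)]
  have hexp4 : Real.exp 4 ≤ 54.61 := by
    have h1 : Real.exp 4 = Real.exp 1 ^ 4 := by rw [← Real.exp_nat_mul]; norm_num
    rw [h1]
    calc Real.exp 1 ^ 4 ≤ 2.7183 ^ 4 := by
          gcongr; exact Real.exp_one_lt_d9.le.trans (by norm_num)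
      _ ≤ _ := by norm_num
  -- Path nodes have depth at most 1, and $9e^{1/2}\le9\cdot1.65=14.85$.
  have hnbr : ∀ u i, (graph R x).Adj u (p i) → ∃ k : ℤ,
      |(x u).2 - (x (p i)).2 - 2 * Real.pi * k| ≤ Real.pi ∧
      |(x u).2 - (x (p i)).2 - 2 * Real.pi * k| ≤ 14.85 * Real.exp (-(x u).1 / 2) := by
    intro u i hadj
    obtain ⟨k, hk1, hk2⟩ := angle_le_of_hdist_le hR0 (hx u).1.1 (hpr1 i)
      (le_trans (by linarith) (hpr1 i)) zero_le_one hadj.2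
    refine ⟨k, hk1, hk2.trans ?_⟩
    gcongr
    linarith
  -- For angles differing by at most 2 no multiple of $2\pi$ intervenes, since $2+\pi<2\pi$.
  have hnbr0 : ∀ u i b, (graph R x).Adj u (p i) → |(x u).2 - (x (p i)).2| ≤ 2 →
      Real.exp (-(x u).1 / 2) ≤ b → |(x u).2 - (x (p i)).2| ≤ 14.85 * b := by
    intro u i b hadj hd hb
    obtain ⟨k, hk1, hk2⟩ := hnbr u i hadj
    have hk0 : k = 0 := by
      have h1 : |2 * Real.pi * (k : ℝ)| < 2 * Real.pi := by
        calc |2 * Real.pi * (k : ℝ)| = |((x u).2 - (x (p i)).2)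
              - ((x u).2 - (x (p i)).2 - 2 * Real.pi * k)| := by congr 1; ring
          _ ≤ |(x u).2 - (x (p i)).2| + |(x u).2 - (x (p i)).2 - 2 * Real.pi * k| := abs_sub _ _
          _ < 2 * Real.pi := by linarith
      rw [abs_mul, abs_of_pos Real.two_pi_pos] at h1
      have h2 : |(k : ℝ)| < 1 := by
        by_contra! h
        nlinarith
      rw [← Int.cast_abs] at h2
      exact Int.abs_lt_one_iff.1 (by exact_mod_cast h2)
    rw [hk0, Int.cast_zero, mul_zero, sub_zero] at hk2
    exact hk2.trans (by linarith)
  have hnbr_pattern : ∀ u i, (graph R x).Adj u (p i) → u = q ∨ ∃ j, u = p j := by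
    intro u i hadj
    have hmem : u ∈ Set.range e := by
      by_contra hu
      apply hfan u hu
      obtain ⟨k, hk1, hk2⟩ := hnbr u i hadj
      rw [pathFan, mem_fan]
      refine ⟨k, ?_, ?_⟩
      · obtain ⟨-, hu0, huπ⟩ := hx u
        obtain ⟨-, hp0, hpπ⟩ := hx (p i)
        rw [abs_le] at hk1
        have h1 : (k : ℝ) < 2 := by
          by_contra! h
          nlinarith
        have h2 : (-2 : ℝ) < k := by
          by_contra! h
          nlinarith
        have h1' : k < 2 := by exact_mod_cast h1
        have h2' : -2 < k := by exact_mod_cast h2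
        have : k = -1 ∨ k = 0 ∨ k = 1 := by omega
        simpa using this
      · rw [abs_le] at hk2 ⊢
        have h3 := hpφ3 i
        have h4 := hpφ4 i
        have h5 := Real.exp_pos (-(x u).1 / 2)
        constructor <;> nlinarith
    obtain ⟨_ | _ | j, rfl⟩ := hmem
    -- The deep node `w` is not a neighbour: its offset from the path exceeds `28 * T * a`, whereas
    -- adjacency would allow at most $14.85\cdot1.65<25$ times `T * a`.
    · exfalso
      have hd : 28 * T * a < (x w).2 - (x (p i)).2 := by linarith [hpφ4 i]
      have hd2 : (x w).2 - (x (p i)).2 ≤ 2 := by nlinarith [hpφ3 i]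
      have hb : Real.exp (-(x w).1 / 2) ≤ 1.65 * (T * a) := by
        calc Real.exp (-(x w).1 / 2) ≤ Real.exp (1 / 2) * (T * a) := by
              rw [hT_def, ha_def, ← Real.exp_add, ← Real.exp_add]
              exact Real.exp_le_exp.2 (by linarith)
          _ ≤ _ := by gcongr
      have hpos : 0 ≤ (x w).2 - (x (p i)).2 := by nlinarith
      have h1 := hnbr0 w i _ hadj (by rwa [abs_of_nonneg hpos]) hb
      rw [abs_of_nonneg hpos] at h1
      nlinarith
    · exact Or.inl rfl
    · exact Or.inr ⟨j, rfl⟩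
  -- the pattern is connected to `K`
  have hadj_of : ∀ u v, u ≠ v → |(x u).1 - (x v).1| ≤ t + 8 →
      Real.exp ((x u).1 + (x v).1) * ((x u).2 - (x v).2) ^ 2 ≤ 2 * Real.exp R →
      (graph R x).Adj u v := by
    intro u v huv hr hφ
    refine ⟨huv, hdist_le_of_angle hR0 (hx u).1.1 (hx v).1.1 ?_ hφ⟩
    rw [← Real.cosh_abs]
    set d := |(x u).1 - (x v).1|
    have h2 : Real.cosh d ≤ Real.exp d := by
      rw [Real.cosh_eq]
      have : Real.exp (-d) ≤ Real.exp d :=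
        Real.exp_le_exp.2 (by linarith [abs_nonneg ((x u).1 - (x v).1)])
      linarith
    refine h2.trans ((Real.exp_le_exp.2 (show d ≤ R - 2 by linarith)).trans ?_)
    rw [Real.exp_sub]
    refine div_le_div_of_nonneg_left (Real.exp_pos R).le (by norm_num) ?_
    have h3 : Real.exp 2 = Real.exp 1 ^ 2 := by rw [← Real.exp_nat_mul]; norm_num
    have h4 := Real.add_one_le_exp (1 : ℝ)
    rw [h3]; nlinarith
  have hKmem : ∀ u v, (graph R x).Adj u v → u ∈ K.supp → v ∈ K.supp := by
    intro u v huv hu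
    rw [SimpleGraph.ConnectedComponent.mem_supp_iff] at hu ⊢
    rw [← hu]
    exact (SimpleGraph.ConnectedComponent.sound huv.reachable).symm
  have hwK : w ∈ K.supp := hK w (by linarith)
  have hqK : q ∈ K.supp := by
    refine hKmem w q (hadj_of w q (e.injective.ne (by simp)) (abs_le.2 ⟨?_, ?_⟩) ?_) hwK
    · linarith
    · linarith
    -- The offset between `w` and `q` is at most $28Ta+a/2\le29Ta$. Placing the hook at radius at
    -- most $R-7$ gains the factor $e^7\ge421$ needed for $29^2=841\le2\cdot421$.
    · have h1 : ((x w).2 - (x q).2) ^ 2 ≤ (29 * T * a) ^ 2 := by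
        apply sq_le_sq' <;> nlinarith
      have h2 : Real.exp ((x w).1 + (x q).1) ≤ Real.exp (2 * R - t - 7) :=
        Real.exp_le_exp.2 (by linarith)
      have h3 : Real.exp (2 * R - t - 7) * (29 * T * a) ^ 2 = 841 * Real.exp (R - 7) := by
        rw [mul_pow, mul_pow, hTT, haa]
        have : Real.exp (2 * R - t - 7) * (Real.exp t * Real.exp (-R)) = Real.exp (R - 7) := by
          rw [← Real.exp_add, ← Real.exp_add]; congr 1; ring
        linear_combination 841 * this
      have h4 : 841 * Real.exp (R - 7) ≤ 2 * Real.exp R := by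
        have h5 : Real.exp R = Real.exp (R - 7) * Real.exp 7 := by
          rw [← Real.exp_add]; congr 1; ring
        have h6 : (421 : ℝ) ≤ Real.exp 7 := by
          have h7 : Real.exp 7 = Real.exp 1 ^ 7 := by rw [← Real.exp_nat_mul]; norm_num
          rw [h7]
          calc (421 : ℝ) ≤ 2.7 ^ 7 := by norm_num
            _ ≤ _ := by gcongr; exact le_trans (by norm_num) Real.exp_one_gt_d9.le
        rw [h5]
        nlinarith [Real.exp_pos (R - 7)]
      calc _ ≤ Real.exp (2 * R - t - 7) * (29 * T * a) ^ 2 := by gcongr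
        _ ≤ _ := by rw [h3]; exact h4
  have hclose : ∀ u v, u ≠ v → R - 8 ≤ (x u).1 → R - 8 ≤ (x v).1 →
      |(x u).2 - (x v).2| ≤ a → (graph R x).Adj u v := by
    intro u v huv hu hv hd
    refine hadj_of u v huv (abs_le.2 ⟨?_, ?_⟩) ?_
    · linarith [(hx v).1.2]
    · linarith [(hx u).1.2]
    · have h1 : ((x u).2 - (x v).2) ^ 2 ≤ a ^ 2 := by
        apply sq_le_sq' <;> linarith [(abs_le.1 hd).1, (abs_le.1 hd).2]
      have h2 : Real.exp ((x u).1 + (x v).1) ≤ Real.exp (2 * R) :=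
        Real.exp_le_exp.2 (by linarith [(hx u).1.2, (hx v).1.2])
      calc _ ≤ Real.exp (2 * R) * a ^ 2 := by gcongr
        _ = Real.exp R := by rw [haa, ← Real.exp_add]; congr 1; ring
        _ ≤ _ := by linarith [Real.exp_pos R]
  -- Membership propagates backwards along the path, starting at the last node, which is adjacent to
  -- the hook.
  have hpK : ∀ d, ∀ i : Fin L, (i : ℕ) + 1 + d = L → p i ∈ K.supp := by
    intro d
    induction d with
    | zero =>
      intro i hi
      refine hKmem q (p i) (hclose _ _ (e.injective.ne (by simp)) hqr1
        (by linarith [hpr1 i]) (abs_le.2 ⟨?_, ?_⟩)) hqK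
      · linarith [hpφ4 i]
      · have h1 : (L : ℝ) = (i : ℕ) + 1 := by exact_mod_cast hi.symm
        rw [h1] at hqφ2
        linarith [hpφ1 i]
    | succ d ih =>
      intro i hi
      let j : Fin L := ⟨i + 1, by omega⟩
      have hij : i ≠ j := fun h => by simpa [j] using congrArg Fin.val h
      have h1 : ((j : ℕ) : ℝ) = (i : ℕ) + 1 := by simp [j]
      have h2 := hpφ1 j
      have h3 := hpφ2 j
      rw [h1] at h2 h3
      refine hKmem (p j) (p i) (hclose _ _ (e.injective.ne (by simpa using hij.symm))
        (by linarith [hpr1 j]) (by linarith [hpr1 i]) (abs_le.2 ⟨?_, ?_⟩))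
        (ih j (by simp only [j]; omega))
      · linarith [hpφ1 i, hpφ2 i]
      · linarith [hpφ1 i, hpφ2 i]
  let i₀ : Fin L := ⟨0, hL⟩
  have hp0K : p i₀ ∈ K.supp := hpK (L - 1) i₀ (by simp only [i₀]; omega)
  -- a Lipschitz function that separates the ends of the path
  classical
  let f : Fin n → ℝ := fun v => if ∃ i, v = p i then (x v).2 - c else L * (a / 2)
  have hfp : ∀ i, f (p i) = (x (p i)).2 - c := fun i => if_pos ⟨i, rfl⟩
  have hqp : ¬ ∃ i, q = p i := by
    rintro ⟨i, hi⟩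
    exact absurd (e.injective hi) (by simp)
  have hfq : f q = L * (a / 2) := if_neg hqp
  have hfadj : ∀ u i, (graph R x).Adj u (p i) → |f u - f (p i)| ≤ 812 * a := by
    intro u i hadj
    rcases hnbr_pattern u i hadj with rfl | ⟨j, rfl⟩
    -- The hook has depth at most 8, hence the factor $e^4$, and $14.85\cdot54.61<812$.
    · have hb : Real.exp (-(x q).1 / 2) ≤ 54.61 * a := by
        calc Real.exp (-(x q).1 / 2) ≤ Real.exp 4 * a := by
              rw [ha_def, ← Real.exp_add]
              exact Real.exp_le_exp.2 (by linarith)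
          _ ≤ _ := by gcongr
      have hpos : 0 ≤ (x q).2 - (x (p i)).2 := by linarith [hpφ4 i]
      have h1 := hnbr0 q i _ hadj (by rw [abs_of_nonneg hpos]; nlinarith [hpφ3 i]) hb
      rw [abs_of_nonneg hpos] at h1
      rw [hfq, hfp, abs_of_nonneg (by linarith [hpφ4 i])]
      linarith
    · have hb : Real.exp (-(x (p j)).1 / 2) ≤ 1.65 * a := by
        calc Real.exp (-(x (p j)).1 / 2) ≤ Real.exp (1 / 2) * a := by
              rw [ha_def, ← Real.exp_add]
              exact Real.exp_le_exp.2 (by linarith [hpr1 j])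
          _ ≤ _ := by gcongr
      have hd : |(x (p j)).2 - (x (p i)).2| ≤ 2 := abs_le.2
        ⟨by nlinarith [hpφ3 i, hpφ4 i, hpφ3 j, hpφ4 j],
          by nlinarith [hpφ3 i, hpφ4 i, hpφ3 j, hpφ4 j]⟩
      have h1 := hnbr0 (p j) i _ hadj hd hb
      rw [hfp, hfp, sub_sub_sub_cancel_right]
      linarith
  have hflip : ∀ u v, (graph R x).Adj u v → |f u - f v| ≤ 812 * a := by
    intro u v huv
    by_cases hv : ∃ i, v = p i
    · obtain ⟨i, rfl⟩ := hv
      exact hfadj u i huv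
    by_cases hu : ∃ i, u = p i
    · obtain ⟨i, rfl⟩ := hu
      rw [abs_sub_comm]
      exact hfadj v i huv.symm
    · simp only [f, if_neg hu, if_neg hv, sub_self, abs_zero]
      positivity
  have hconn := K.connected_toSimpleGraph
  have hdist := SimpleGraph.abs_sub_le_mul_dist hconn (f := fun v : K => f v)
    (fun u v huv => hflip u v (K.toSimpleGraph_hom.map_adj huv)) ⟨p i₀, hp0K⟩ ⟨q, hqK⟩
  have hne : Nonempty K := ⟨⟨q, hqK⟩⟩
  have hdiam : (K.toSimpleGraph.dist ⟨p i₀, hp0K⟩ ⟨q, hqK⟩ : ℝ) ≤ K.toSimpleGraph.diam := by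
    exact_mod_cast SimpleGraph.dist_le_diam (SimpleGraph.connected_iff_ediam_ne_top.1 hconn)
  have h0 : f (p i₀) ≤ a / 2 := by
    rw [hfp]
    have := hpφ2 i₀
    simp only [i₀, Nat.cast_zero, zero_mul, add_zero] at this
    linarith
  have h1 : L * (a / 2) - a / 2 ≤ 812 * a * K.toSimpleGraph.diam := by
    calc L * (a / 2) - a / 2 ≤ -(f (p i₀) - f q) := by rw [hfq]; linarith
      _ ≤ |f (p i₀) - f q| := neg_le_abs _
      _ ≤ _ := hdist
      _ ≤ _ := by gcongr
  have h2 : a * ((L : ℝ) - 1) ≤ a * (1624 * K.toSimpleGraph.diam) := by linarith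
  exact le_of_mul_le_mul_left h2 ha


/-! ### Empty sectors and close pairs are unlikely -/

theorem measureReal_pi_forall_notMem {X : Type*} [MeasurableSpace X] (ν : Measure X)
    [IsProbabilityMeasure ν] {Q : Set X} (hQ : MeasurableSet Q) (n : ℕ) :
    (Measure.pi fun _ : Fin n => ν).real {x | ∀ v, x v ∉ Q} = (1 - ν.real Q) ^ n := by
  have : {x : Fin n → X | ∀ v, x v ∉ Q} = Set.univ.pi fun _ => Qᶜ := by
    ext; simp
  rw [this, measureReal_def, Measure.pi_pi, ENNReal.toReal_prod, Finset.prod_const,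
    ← measureReal_def, probReal_compl_eq_one_sub hQ]
  simp

/-- With high probability every sector contains a node of depth at least `t`. -/
theorem measureReal_exists_empty_sector_le {α R t ω : ℝ} {n N : ℕ} (hα : 0 < α) (ht : 0 ≤ t)
    (htR : t + 1 ≤ R) (hN : 0 < N) (hω : N * ω = 2 * Real.pi) :
    (Measure.pi fun _ : Fin n => nodeLaw α R).real
      {x | ∃ j < N, ∀ v, ¬ ((x v).1 ≤ R - t ∧ (x v).2 ∈ Set.Ico (j * ω) (j * ω + ω))}
      ≤ N * Real.exp (-(n * ((Real.cosh α - 1) / 2 * Real.exp (-(α * (t + 1))) / N))) := by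
  have := isProbabilityMeasure_nodeLaw hα (by linarith : 0 < R)
  set P := Measure.pi fun _ : Fin n => nodeLaw α R
  have hN' : (0 : ℝ) < N := by exact_mod_cast hN
  have hω0 : 0 < ω := by
    by_contra! h
    nlinarith [Real.pi_pos]
  set p := (Real.cosh α - 1) / 2 * Real.exp (-(α * (t + 1))) / N with hp_def
  have hone : ∀ j < N, P.real {x | ∀ v, x v ∉ Set.Iic (R - t) ×ˢ Set.Ico (j * ω) (j * ω + ω)}
      ≤ Real.exp (-(n * p)) := by
    intro j hj
    have hj' : (j : ℝ) + 1 ≤ N := by exact_mod_cast hj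
    rw [measureReal_pi_forall_notMem _ (measurableSet_Iic.prod measurableSet_Ico)]
    have h1 : p ≤ (nodeLaw α R).real (Set.Iic (R - t) ×ˢ Set.Ico (j * ω) (j * ω + ω)) := by
      have h2 := le_nodeLaw_box (R := R) (r := R - t - 1) (φ := j * ω) (h := ω) hα
        (by linarith) (by linarith) (by positivity) (by nlinarith)
      have h3 : (Real.cosh α - 1) / 2 * Real.exp (-(α * (R - (R - t - 1)))) * (ω / (2 * Real.pi))
          = p := by
        rw [← hω, hp_def]
        field_simp
        ring_nf
      rw [h3] at h2
      refine h2.trans (measureReal_mono (Set.prod_mono (fun r hr => ?_) subset_rfl))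
      have := hr.2
      simp only [Set.mem_Iic]; linarith
    have h4 : (nodeLaw α R).real (Set.Iic (R - t) ×ˢ Set.Ico (j * ω) (j * ω + ω)) ≤ 1 :=
      measureReal_le_one
    calc _ ≤ (1 - p) ^ n := pow_le_pow_left₀ (by linarith) (by linarith) n
      _ ≤ Real.exp (-p) ^ n :=
        pow_le_pow_left₀ (by linarith) (Real.one_sub_le_exp_neg p) n
      _ = _ := by rw [← Real.exp_nat_mul]; ring_nf
  have hsub : {x : Fin n → ℝ × ℝ | ∃ j < N, ∀ v, ¬ ((x v).1 ≤ R - t ∧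
      (x v).2 ∈ Set.Ico (j * ω) (j * ω + ω))} ⊆ ⋃ j ∈ Finset.range N,
      {x | ∀ v, x v ∉ Set.Iic (R - t) ×ˢ Set.Ico (j * ω) (j * ω + ω)} := by
    rintro x ⟨j, hj, h⟩
    simp only [Set.mem_iUnion]
    exact ⟨j, Finset.mem_range.2 hj, h⟩
  refine (measureReal_mono hsub (measure_ne_top _ _)).trans
    ((measureReal_biUnion_finset_le _ _).trans ?_)
  refine (Finset.sum_le_sum fun j hj => hone j (Finset.mem_range.1 hj)).trans (le_of_eq ?_)
  simp

theorem measurableSet_closePairs (ω : ℝ) : MeasurableSet (closePairs ω) := by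
  have h : Measurable fun p : (ℝ × ℝ) × (ℝ × ℝ) => |p.1.2 - p.2.2| := by fun_prop
  refine ((measurable_snd.comp measurable_fst) measurableSet_Ico).inter
    (((measurable_snd.comp measurable_snd) measurableSet_Ico).inter ?_)
  exact (measurableSet_le h measurable_const).union (measurableSet_le measurable_const h)

/-- Given the first angle, the second lies in an interval of length $6\omega$ around it or in one of
two end intervals of length $2\omega$. -/
theorem prod_closePairs_le {α R ω : ℝ} (hα : 0 < α) (hR : 0 < R) (hω : 0 ≤ ω) :
    ((nodeLaw α R).prod (nodeLaw α R)).real (closePairs ω) ≤ 10 * ω / (2 * Real.pi) := by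
  have := isProbabilityMeasure_radialLaw hα hR
  have := isProbabilityMeasure_nodeLaw hα hR
  have hpi := Real.pi_pos
  rw [measureReal_def]
  apply ENNReal.toReal_le_of_le_ofReal (by positivity)
  rw [Measure.prod_apply (measurableSet_closePairs ω)]
  have hslice : ∀ p : ℝ × ℝ, nodeLaw α R (Prod.mk p ⁻¹' closePairs ω)
      ≤ ENNReal.ofReal (10 * ω / (2 * Real.pi)) := by
    intro p
    set s := Set.Icc (p.2 - 3 * ω) (p.2 + 3 * ω) ∪ (Set.Icc 0 (2 * ω)
      ∪ Set.Icc (2 * Real.pi - 2 * ω) (2 * Real.pi))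
    have hsub : Prod.mk p ⁻¹' closePairs ω ⊆ Set.univ ×ˢ s := by
      rintro q ⟨⟨hp0, hp1⟩, ⟨hq0, hq1⟩, h⟩
      refine ⟨trivial, ?_⟩
      dsimp only at hp0 hp1 hq0 hq1 h
      rcases h with h | h
      · left
        rw [abs_le] at h
        exact ⟨by linarith [h.2], by linarith [h.1]⟩
      · right
        rcases le_abs.1 h with h | h
        · left; exact ⟨hq0, by linarith⟩
        · right; exact ⟨by linarith, hq1.le⟩
    refine (measure_mono hsub).trans ?_
    rw [nodeLaw, Measure.prod_prod, measure_univ, one_mul]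
    apply angularLaw_le
    refine (measure_union_le _ _).trans ((add_le_add le_rfl (measure_union_le _ _)).trans ?_)
    rw [Real.volume_Icc, Real.volume_Icc, Real.volume_Icc, ← ENNReal.ofReal_add (by linarith)
      (by linarith), ← ENNReal.ofReal_add (by linarith) (by linarith)]
    exact ENNReal.ofReal_le_ofReal (by linarith)
  refine (lintegral_mono hslice).trans ?_
  rw [lintegral_const, measure_univ, mul_one]

open Classical in
/-- With high probability there are few pairs of nodes with close angles. -/
theorem measureReal_many_closePairs_le {α R ω : ℝ} {n N : ℕ} (hα : 0 < α) (hR : 0 < R)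
    (hN : 0 < N) (hω : N * ω = 2 * Real.pi) :
    (Measure.pi fun _ : Fin n => nodeLaw α R).real
      {x | N ^ 2 ≤ (Finset.univ.filter fun p : Fin n × Fin n =>
        (x p.1, x p.2) ∈ closePairs ω).card}
      ≤ (n + 10 * n ^ 2 / N) / N ^ 2 := by
  have := isProbabilityMeasure_nodeLaw hα hR
  set P := Measure.pi fun _ : Fin n => nodeLaw α R
  have hN' : (0 : ℝ) < N := by exact_mod_cast hN
  have hω0 : 0 ≤ ω := by
    by_contra! h
    nlinarith [Real.pi_pos]
  let A : Fin n × Fin n → Set (Fin n → ℝ × ℝ) := fun p => {x | (x p.1, x p.2) ∈ closePairs ω}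
  have hA : ∀ p, MeasurableSet (A p) := fun p =>
    (measurableSet_closePairs ω).preimage (by fun_prop)
  -- Diagonal pairs may always be close; distinct nodes are independent, and $10\omega/(2\pi)=10/N$.
  have hPA : ∀ p, P.real (A p) ≤ (if p.1 = p.2 then 1 else 0) + 10 / N := by
    intro p
    split_ifs with h
    · have : P.real (A p) ≤ 1 := measureReal_le_one
      have : (0 : ℝ) ≤ 10 / N := by positivity
      linarith
    · have hind : iIndepFun (fun i (x : Fin n → ℝ × ℝ) => x i) P :=
        iIndepFun_pi (X := fun _ => id) fun _ => aemeasurable_id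
      have h1 := (hind.indepFun h).map_prod_eq_prod_map_map
        (measurable_pi_apply _).aemeasurable (measurable_pi_apply _).aemeasurable
      have h2 : ∀ i, P.map (fun x => x i) = nodeLaw α R := fun i =>
        (measurePreserving_eval (fun _ : Fin n => nodeLaw α R) i).map_eq
      rw [h2, h2] at h1
      have h3 : P.real (A p) = ((nodeLaw α R).prod (nodeLaw α R)).real (closePairs ω) := by
        rw [← h1, map_measureReal_apply (by fun_prop) (measurableSet_closePairs ω)]
        rfl
      rw [h3, zero_add]
      refine (prod_closePairs_le hα hR hω0).trans (le_of_eq ?_)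
      rw [← hω]
      have : ω ≠ 0 := by
        rintro rfl
        linarith [Real.pi_pos, mul_zero (N : ℝ)]
      field_simp
  set F : (Fin n → ℝ × ℝ) → ℝ := fun x => ∑ p, (A p).indicator 1 x
  have hint : ∀ p, Integrable ((A p).indicator (1 : (Fin n → ℝ × ℝ) → ℝ)) P := fun p =>
    (integrable_const 1).indicator (hA p)
  have hF : ∀ x, F x = (Finset.univ.filter fun p : Fin n × Fin n =>
        (x p.1, x p.2) ∈ closePairs ω).card := by
    intro x
    simp only [F, Set.indicator_apply, A, Pi.one_apply, Set.mem_ofPred_eq]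
    simp
  have hmarkov := mul_meas_ge_le_integral_of_nonneg (μ := P) (f := F)
    (ae_of_all _ fun x => Finset.sum_nonneg fun p _ => Set.indicator_nonneg (by simp) _)
    (integrable_finsetSum _ fun p _ => hint p) ((N : ℝ) ^ 2)
  have hsum : ∫ x, F x ∂P ≤ n + 10 * n ^ 2 / N := by
    simp only [F]
    rw [integral_finsetSum _ fun p _ => hint p]
    simp_rw [integral_indicator_one (hA _)]
    refine (Finset.sum_le_sum fun p _ => hPA p).trans (le_of_eq ?_)
    rw [Finset.sum_add_distrib, Fintype.sum_prod_type]
    simp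
    ring
  rw [le_div_iff₀ (by positivity), mul_comm]
  refine le_trans (mul_le_mul_of_nonneg_left (measureReal_mono fun x hx => ?_) (by positivity))
    (hmarkov.trans hsum)
  simp only [Set.mem_ofPred_eq] at hx ⊢
  rw [hF]
  exact_mod_cast hx

/-! ### Some dangling path occurs -/

/-- Centres in $[0,1]$ stay $\sigma$ apart on the circle, so a common point satisfies
$\sigma\le2(\sigma/4+30e^{-r/2})$. Only nodes of small radius can therefore correlate two sites. -/
theorem fan_inter_fan_subset {c c' b σ : ℝ} (hσ : σ ≤ 1) (hσ0 : 0 < σ) (hc : c ∈ Set.Icc 0 1)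
    (hc' : c' ∈ Set.Icc 0 1) (hcc : σ ≤ |c - c'|) (hb : b ≤ σ / 4) :
    fan c b 30 ∩ fan c' b 30 ⊆ {p | p.1 ≤ 2 * Real.log (120 / σ)} := by
  rintro p ⟨h, h'⟩
  rw [mem_fan] at h h'
  obtain ⟨k, -, hk⟩ := h
  obtain ⟨k', -, hk'⟩ := h'
  have h1 : σ ≤ |c - c' + 2 * Real.pi * (k - k' : ℤ)| := by
    by_cases hkk : k = k'
    · simpa [hkk] using hcc
    · have h2 : (1 : ℝ) ≤ |((k - k' : ℤ) : ℝ)| := by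
        rw [← Int.cast_abs]
        exact_mod_cast Int.one_le_abs (sub_ne_zero.2 hkk)
      have h3 : |2 * Real.pi * ((k - k' : ℤ) : ℝ)| = 2 * Real.pi * |((k - k' : ℤ) : ℝ)| := by
        rw [abs_mul, abs_of_pos Real.two_pi_pos]
      have h4 : |c - c'| ≤ 1 := abs_le.2 ⟨by linarith [hc.1, hc'.2], by linarith [hc.2, hc'.1]⟩
      have h5 := abs_sub_abs_le_abs_add (2 * Real.pi * ((k - k' : ℤ) : ℝ)) (c - c')
      rw [add_comm (c - c')]
      nlinarith [Real.pi_gt_three]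
  have h2 : |c - c' + 2 * Real.pi * (k - k' : ℤ)| ≤ 2 * (b + 30 * Real.exp (-p.1 / 2)) := by
    calc _ = |(p.2 - c' - 2 * Real.pi * k') - (p.2 - c - 2 * Real.pi * k)| := by
          congr 1; push_cast; ring
      _ ≤ _ := (abs_sub _ _).trans (by linarith)
  have h3 : σ / 120 ≤ Real.exp (-p.1 / 2) := by linarith
  have h4 := (Real.le_log_iff_exp_le (x := p.1 / 2) (y := 120 / σ) (by positivity)).2 (by
    rw [le_div_iff₀ hσ0]
    have : Real.exp (p.1 / 2) * Real.exp (-p.1 / 2) = 1 := by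
      rw [← Real.exp_add]; ring_nf; simp
    have h5 := mul_le_mul_of_nonneg_left h3 (Real.exp_pos (p.1 / 2)).le
    linarith)
  simp only [Set.mem_ofPred_eq]
  linarith

theorem disjoint_pathBox_of_ne {R t c c' σ : ℝ} {L : ℕ} (hcc : σ ≤ |c - c'|)
    (hσ : L * (Real.exp (-R / 2) / 2) + 28 * Real.exp (t / 2) * Real.exp (-R / 2)
      + Real.exp (-R / 2) / 2 ≤ σ) (i j : Option (Option (Fin L))) :
    Disjoint (pathBox R t c i) (pathBox R t c' j) := by
  rw [Set.disjoint_left]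
  rintro p ⟨-, h1, h2⟩ ⟨-, h3, h4⟩
  have := boxAngle_nonneg R t i
  have := boxAngle_nonneg R t j
  have := boxAngle_le R t i
  have := boxAngle_le R t j
  rcases le_abs.1 hcc with h | h <;> linarith


theorem one_sub_inv_pow_le {u b : ℝ} (hu0 : 0 ≤ u) (hub : u ≤ b) (hu : u ≤ 1 / 2) (k : ℕ) :
    Real.exp (-(2 * b * k)) ≤ (1 - u) ^ k := by
  have h1 : Real.exp (-(2 * u)) ≤ 1 - u := by
    rw [Real.exp_neg, inv_le_comm₀ (Real.exp_pos _) (by linarith)]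
    have h2 := Real.add_one_le_exp (2 * u)
    refine le_trans ?_ h2
    rw [inv_le_iff_one_le_mul₀ (by linarith)]
    nlinarith
  calc Real.exp (-(2 * b * k)) ≤ Real.exp (k * (-(2 * u))) := by
        apply Real.exp_le_exp.2
        have : (0 : ℝ) ≤ k := Nat.cast_nonneg k
        nlinarith
    _ = Real.exp (-(2 * u)) ^ k := by rw [Real.exp_nat_mul]
    _ ≤ _ := pow_le_pow_left₀ (Real.exp_pos _).le h1 k

/-- The correlation estimate for two patterns whose forbidden regions `U`, `U'` overlap little. -/
theorem one_sub_union_pow_le {u u' z v b : ℝ} {n k : ℕ} (hu0 : 0 ≤ u) (hu'0 : 0 ≤ u')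
    (hub : u ≤ b) (hub' : u' ≤ b) (hb : b ≤ 1 / 2) (hv : 0 ≤ v) (hz1 : z ≤ 1)
    (hz : u + u' - v ≤ z) (hk : k + k ≤ n) :
    (1 - z) ^ (n - (k + k))
      ≤ Real.exp (4 * v * n + 4 * b * k) * ((1 - u) ^ (n - k) * (1 - u') ^ (n - k)) := by
  -- The additive error $v$ becomes a factor $1+4v$ because $(1-u)(1-u')\ge1/4$.
  have h1 : 1 - z ≤ (1 + 4 * v) * ((1 - u) * (1 - u')) := by
    have h2 : 1 / 4 ≤ (1 - u) * (1 - u') := by nlinarith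
    nlinarith [mul_nonneg hu0 hu'0, mul_nonneg hv (sub_nonneg.2 h2)]
  have h4 : (1 + 4 * v) ^ (n - (k + k)) ≤ Real.exp (4 * v * n) := by
    calc _ ≤ Real.exp (4 * v) ^ (n - (k + k)) := by
          gcongr; linarith [Real.add_one_le_exp (4 * v)]
      _ = Real.exp ((n - (k + k) : ℕ) * (4 * v)) := by rw [Real.exp_nat_mul]
      _ ≤ Real.exp (4 * v * n) := by
          apply Real.exp_le_exp.2
          have : ((n - (k + k) : ℕ) : ℝ) ≤ n := by exact_mod_cast Nat.sub_le _ _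
          nlinarith
  -- Replacing the exponent $n-2k$ by $n-k$ costs a factor $e^{2bk}$.
  have h5 : ∀ w, 0 ≤ w → w ≤ b →
      (1 - w) ^ (n - (k + k)) ≤ Real.exp (2 * b * k) * (1 - w) ^ (n - k) := by
    intro w hw0 hwb
    have h6 := one_sub_inv_pow_le hw0 hwb (hwb.trans hb) k
    have h7 : n - k = n - (k + k) + k := by omega
    have h8 : 1 ≤ Real.exp (2 * b * k) * (1 - w) ^ k := by
      calc (1 : ℝ) = Real.exp (2 * b * k) * Real.exp (-(2 * b * k)) := by
            rw [← Real.exp_add]; simp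
        _ ≤ _ := by gcongr
    have h9 : 0 ≤ (1 - w) ^ (n - (k + k)) := pow_nonneg (by linarith) _
    rw [h7, pow_add]
    nlinarith
  calc (1 - z) ^ (n - (k + k)) ≤ ((1 + 4 * v) * ((1 - u) * (1 - u'))) ^ (n - (k + k)) :=
        pow_le_pow_left₀ (by linarith) h1 _
    _ = (1 + 4 * v) ^ (n - (k + k)) * ((1 - u) ^ (n - (k + k)) * (1 - u') ^ (n - (k + k))) := by
        rw [mul_pow, mul_pow]
    _ ≤ Real.exp (4 * v * n) * ((Real.exp (2 * b * k) * (1 - u) ^ (n - k))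
          * (Real.exp (2 * b * k) * (1 - u') ^ (n - k))) := by
        have p1 : 0 ≤ (1 - u) := by linarith
        have p2 : 0 ≤ (1 - u') := by linarith
        gcongr
        · exact h5 u hu0 hub
        · exact h5 u' hu'0 hub'
    _ = _ := by
        rw [show 4 * v * (n : ℝ) + 4 * b * k = 4 * v * n + (2 * b * k + 2 * b * k) by ring,
          Real.exp_add, Real.exp_add]
        ring

theorem half_pow_le_descFactorial {n k : ℕ} (hk : k + k ≤ n) :
    ((n : ℝ) / 2) ^ k ≤ n.descFactorial k := by
  refine le_trans ?_ (by exact_mod_cast Nat.pow_sub_le_descFactorial n k :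
    (((n + 1 - k) ^ k : ℕ) : ℝ) ≤ _)
  push_cast
  gcongr
  rw [Nat.cast_sub (by omega)]
  have : (k : ℝ) + k ≤ n := by exact_mod_cast hk
  push_cast
  linarith

/-- A lower bound for the mass, in units of `e^{-R / 2}`, of the boxes at bounded depth. -/
noncomputable def boxMass (α : ℝ) : ℝ :=
  (Real.cosh α - 1) / 2 * Real.exp (-(8 * α)) / (4 * Real.pi)

theorem boxMass_pos {α : ℝ} (hα : 0 < α) : 0 < boxMass α := by
  have := Real.one_lt_cosh.2 hα.ne'
  have : 0 < (Real.cosh α - 1) / 2 := by linarith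
  unfold boxMass
  positivity

/-- Each box has angular width $e^{-R/2}/2$ and, apart from the deep one, inner depth at most 8;
this explains `boxMass`. The deep box, at inner depth $t+1$, costs the extra factor $e^{-\alpha t}$.
-/
theorem le_prod_pathBox {α R t c : ℝ} {L : ℕ} (hα : 0 < α) (ht : 0 ≤ t) (hRt : t + 10 ≤ R)
    (hc : 0 ≤ c)
    (hfit : c + (L * (Real.exp (-R / 2) / 2) + 28 * Real.exp (t / 2) * Real.exp (-R / 2))
      + Real.exp (-R / 2) / 2 ≤ 2 * Real.pi) :
    (boxMass α * Real.exp (-R / 2)) ^ (L + 2) * Real.exp (-(α * t))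
      ≤ ∏ i : Option (Option (Fin L)), (nodeLaw α R).real (pathBox R t c i) := by
  have hκ := boxMass_pos hα
  set a := Real.exp (-R / 2) with ha_def
  have ha : 0 < a := Real.exp_pos _
  have hcosh := Real.one_le_cosh α
  have hone : ∀ i : Option (Option (Fin L)), 0 ≤ boxRadius R t i → boxRadius R t i + 1 ≤ R →
      ∀ d, R - boxRadius R t i ≤ d + 8 →
      boxMass α * a * Real.exp (-(α * d)) ≤ (nodeLaw α R).real (pathBox R t c i) := by
    intro i h0 h1 d hd
    have h2 := boxAngle_nonneg R t i
    have h3 := boxAngle_le R t i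
    refine le_trans ?_ (le_nodeLaw_box (r := boxRadius R t i) hα h0 h1
      (φ := c + boxAngle R t i) (h := a / 2) (by linarith) (by linarith))
    have h4 : Real.exp (-(8 * α)) * Real.exp (-(α * d))
        ≤ Real.exp (-(α * (R - boxRadius R t i))) := by
      rw [← Real.exp_add]
      exact Real.exp_le_exp.2 (by nlinarith)
    calc boxMass α * a * Real.exp (-(α * d)) = (Real.cosh α - 1) / 2
          * (Real.exp (-(8 * α)) * Real.exp (-(α * d))) * (a / 2 / (2 * Real.pi)) := by
          unfold boxMass; field_simp; norm_num
      _ ≤ _ := by gcongr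
  rw [Fintype.prod_option, Fintype.prod_option]
  have hw := hone none (by simp only [boxRadius]; linarith) (by simp only [boxRadius]; linarith)
    t (by simp only [boxRadius]; linarith)
  have hq := hone (some none) (by simp only [boxRadius]; linarith)
    (by simp only [boxRadius]; linarith) 0 (by simp only [boxRadius]; linarith)
  have hp : ∀ i : Fin L, boxMass α * a ≤ (nodeLaw α R).real (pathBox R t c (some (some i))) := by
    intro i
    simpa using hone (some (some i)) (by simp only [boxRadius]; linarith)
      (by simp only [boxRadius]; linarith) 0 (by simp only [boxRadius]; linarith)
  have hprod : (boxMass α * a) ^ L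
      ≤ ∏ i : Fin L, (nodeLaw α R).real (pathBox R t c (some (some i))) := by
    calc (boxMass α * a) ^ L = ∏ _i : Fin L, boxMass α * a := by simp
      _ ≤ _ := Finset.prod_le_prod (fun _ _ => by positivity) fun i _ => hp i
  rw [mul_zero, neg_zero, Real.exp_zero, mul_one] at hq
  calc _ = (boxMass α * a * Real.exp (-(α * t))) * (boxMass α * a * (boxMass α * a) ^ L) := by
        ring
    _ ≤ _ := by gcongr

/-- With high probability the pattern occurs at one of the angles `s / M`. -/
theorem measureReal_no_path_le {α R t b v : ℝ} {n L M : ℕ} (hα : 1 / 2 < α) (ht : 0 ≤ t)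
    (hRt : t + 10 ≤ R) (hαR : 4 ≤ Real.exp (α * R)) (hL : 1 ≤ L) (hM : 0 < M)
    (hfit : M * (4 * (L + 1) * Real.exp (-R / 2) + 1000 * Real.exp (t / 2) * Real.exp (-R / 2))
      ≤ 1)
    (hn : (L + 2) + (L + 2) ≤ n)
    (hb : b = (L + 30 * (2 * α / (α - 1 / 2))) * Real.exp (-R / 2)) (hb2 : b ≤ 1 / 2)
    (hMR : 2 * Real.log (120 * M) ≤ R)
    (hv : v = 4 * Real.exp (-(α * (R - 2 * Real.log (120 * M))))) :
    (Measure.pi fun _ : Fin n => nodeLaw α R).real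
      {x | ∀ s : Fin M, ∀ e : Option (Option (Fin L)) ↪ Fin n,
        x ∉ patternEvent (pathBox R t (s / M)) (pathFan R (s / M) L) e}
      ≤ 1 / (M * (boxMass α * (n * Real.exp (-R / 2) / 2)) ^ (L + 2) * Real.exp (-(α * t))
          * Real.exp (-(2 * b * n))) + Real.exp (4 * v * n + 4 * b * (L + 2)) - 1 := by
  have hα0 : 0 < α := by linarith
  have hR : 0 < R := by linarith
  have := isProbabilityMeasure_nodeLaw hα0 hR
  have hκ := boxMass_pos hα0
  set a := Real.exp (-R / 2) with ha_def
  have ha : 0 < a := Real.exp_pos _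
  have hM' : (1 : ℝ) ≤ M := by exact_mod_cast hM
  have hL' : (1 : ℝ) ≤ L := by exact_mod_cast hL
  have hn0 : (0 : ℝ) < n := by
    have : 0 < n := by omega
    exact_mod_cast this
  have hT : 0 < Real.exp (t / 2) * a := by positivity
  have hfit' : 4 * (L + 1) * a + 1000 * Real.exp (t / 2) * a ≤ 1 / M := by
    rw [le_div_iff₀ (by linarith), mul_comm]; exact hfit
  have hM1 : 1 / (M : ℝ) ≤ 1 := by rw [div_le_one (by linarith)]; exact hM'
  have hσ0 : 0 < 1 / (M : ℝ) := by positivity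
  have hc : ∀ s : Fin M, (s : ℝ) / M ∈ Set.Icc 0 1 := by
    intro s
    refine ⟨by positivity, ?_⟩
    rw [div_le_one (by linarith)]
    exact_mod_cast s.2.le
  have hcc : ∀ s s' : Fin M, s ≠ s' → 1 / (M : ℝ) ≤ |(s : ℝ) / M - s' / M| := by
    intro s s' hs
    rw [← sub_div, abs_div, abs_of_pos (by linarith : (0 : ℝ) < M)]
    gcongr
    have h1 : ((s : ℕ) : ℤ) - (s' : ℕ) ≠ 0 := by
      intro h
      apply hs
      ext
      omega
    have h2 := Int.one_le_abs h1
    exact_mod_cast h2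
  have hu : ∀ s : Fin M, (nodeLaw α R).real (pathFan R (s / M) L) ≤ b := by
    intro s
    refine (nodeLaw_fan_le hα hR hαR (by positivity) (by norm_num)).trans (le_of_eq ?_)
    rw [hb]; ring
  have hcard : Fintype.card (Option (Option (Fin L))) = L + 2 := by simp
  have hlog : 0 ≤ 2 * Real.log (120 * M) :=
    mul_nonneg (by norm_num) (Real.log_nonneg (by linarith))
  refine (measureReal_no_pattern_le (nodeLaw α R) (B := fun s : Fin M => pathBox R t (s / M))
    (U := fun s : Fin M => pathFan R (s / M) L)
    (m := M * (boxMass α * (n * a / 2)) ^ (L + 2) * Real.exp (-(α * t))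
          * Real.exp (-(2 * b * n)))
    (ρ := Real.exp (4 * v * n + 4 * b * (L + 2)))
    (fun s i => measurableSet_pathBox R t _ i) (fun s => measurableSet_fan _ _ _)
    (fun s i => pathBox_subset_pathFan hL i) (fun s i j hij => disjoint_pathBox ht hij)
    (fun s s' hs i j => disjoint_pathBox_of_ne (hcc s s' hs) ?_ i j) ?_ ?_
    (Real.exp_pos _).le ?_)
  · rw [← ha_def]; nlinarith
  · positivity
  · intro s s' hs
    rw [hcard]
    -- The centres are $\sigma=1/M$ apart, so common points have radius at most $2\log(120M)$.
    have hvn : (nodeLaw α R).real (pathFan R (s / M) L ∩ pathFan R (s' / M) L) ≤ v := by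
      have hsub := fan_inter_fan_subset (b := L * a) hM1 hσ0 (hc s) (hc s') (hcc s s' hs)
        (by nlinarith)
      refine (measureReal_mono hsub).trans ?_
      rw [one_div, div_inv_eq_mul, hv]
      exact nodeLaw_radius_le hα0 hR hlog hMR hαR
    have hunion := measureReal_union_add_inter (μ := nodeLaw α R)
      (s := pathFan R (s / M) L) (t := pathFan R (s' / M) L) (measurableSet_fan _ _ _)
    have := one_sub_union_pow_le (u := (nodeLaw α R).real (pathFan R (s / M) L))
      (u' := (nodeLaw α R).real (pathFan R (s' / M) L))
      (z := (nodeLaw α R).real (pathFan R (s / M) L ∪ pathFan R (s' / M) L)) (v := v)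
      (n := n) (k := L + 2) measureReal_nonneg measureReal_nonneg (hu s) (hu s') hb2
      (by rw [hv]; positivity) measureReal_le_one (by linarith) hn
    push_cast at this
    exact this
  · rw [hcard]
    have hone : ∀ s : Fin M, (boxMass α * (n * a / 2)) ^ (L + 2) * Real.exp (-(α * t))
          * Real.exp (-(2 * b * n)) ≤ (n.descFactorial (L + 2) : ℝ)
          * (∏ i : Option (Option (Fin L)), (nodeLaw α R).real (pathBox R t (s / M) i))
          * (1 - (nodeLaw α R).real (pathFan R (s / M) L)) ^ (n - (L + 2)) := by
      intro s
      have h1 := half_pow_le_descFactorial hn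
      have h2 := le_prod_pathBox (c := s / M) (L := L) hα0 ht hRt (hc s).1
        (by rw [← ha_def]; nlinarith [(hc s).2, Real.pi_gt_three])
      have hu0 : 0 ≤ (nodeLaw α R).real (pathFan R (s / M) L) := measureReal_nonneg
      have h3 := one_sub_inv_pow_le hu0 (hu s) ((hu s).trans hb2) (n - (L + 2))
      have h4 : Real.exp (-(2 * b * n)) ≤ Real.exp (-(2 * b * (n - (L + 2) : ℕ))) := by
        apply Real.exp_le_exp.2
        have h5 : ((n - (L + 2) : ℕ) : ℝ) ≤ n := by exact_mod_cast Nat.sub_le _ _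
        have h6 : 0 ≤ b := hu0.trans (hu s)
        nlinarith
      calc _ = ((n : ℝ) / 2) ^ (L + 2) * ((boxMass α * a) ^ (L + 2) * Real.exp (-(α * t)))
            * Real.exp (-(2 * b * n)) := by
            rw [show boxMass α * (n * a / 2) = (n / 2) * (boxMass α * a) by ring, mul_pow]
            ring
        _ ≤ _ := by
            gcongr
            exact h4.trans h3
    calc _ = ∑ _s : Fin M, (boxMass α * (n * a / 2)) ^ (L + 2) * Real.exp (-(α * t))
          * Real.exp (-(2 * b * n)) := by
          rw [Finset.sum_const, Finset.card_univ, Fintype.card_fin, nsmul_eq_mul]; ring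
      _ ≤ _ := Finset.sum_le_sum fun s _ => hone s


-- Off three bad events and a null set the two deterministic results give the diameter bound. Only
-- subadditivity is used, so the good event need not be shown measurable.
open Classical in
theorem one_sub_le_measureReal_diam {α C R t ω D δ₁ δ₂ δ₃ : ℝ} {n N L M : ℕ} (hα : 0 < α)
    (hR : R = radius C n) (ht : 4 ≤ Real.exp t) (ht0 : 0 ≤ t) (hRt : t + 10 ≤ R)
    (hN : 0 < N) (hω : N * ω = 2 * Real.pi) (hωt : 2 * ω ≤ Real.exp (t - R / 2)) (hL : 1 ≤ L)
    (hsmall : (L + 1) * Real.exp (-R / 2) + 1000 * Real.exp (t / 2) * Real.exp (-R / 2) ≤ 1)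
    (hD : 1624 * D ≤ L - 1)
    (h₁ : (Measure.pi fun _ : Fin n => nodeLaw α R).real
      {x | ∃ j < N, ∀ v, ¬ ((x v).1 ≤ R - t ∧ (x v).2 ∈ Set.Ico (j * ω) (j * ω + ω))} ≤ δ₁)
    (h₂ : (Measure.pi fun _ : Fin n => nodeLaw α R).real
      {x | N ^ 2 ≤ (Finset.univ.filter fun p : Fin n × Fin n =>
        (x p.1, x p.2) ∈ closePairs ω).card} ≤ δ₂)
    (h₃ : (Measure.pi fun _ : Fin n => nodeLaw α R).real
      {x | ∀ s : Fin M, ∀ e : Option (Option (Fin L)) ↪ Fin n,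
        x ∉ patternEvent (pathBox R t (s / M)) (pathFan R (s / M) L) e} ≤ δ₃) :
    1 - (δ₁ + δ₂ + δ₃) ≤ (positionLaw α C n).real
      {x | ∀ K : (graph (radius C n) x).ConnectedComponent, IsGiant K →
        D ≤ K.toSimpleGraph.diam} := by
  have hR0 : 0 < R := by linarith
  have := isProbabilityMeasure_nodeLaw hα hR0
  have hpos : positionLaw α C n = Measure.pi fun _ : Fin n => nodeLaw α R := by
    rw [hR]; rfl
  rw [hpos, ← hR]
  set P := Measure.pi fun _ : Fin n => nodeLaw α R
  set G := {x : Fin n → ℝ × ℝ | ∀ K : (graph R x).ConnectedComponent, IsGiant K →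
        D ≤ K.toSimpleGraph.diam}
  set A₁ := {x : Fin n → ℝ × ℝ | ∃ j < N, ∀ v,
    ¬ ((x v).1 ≤ R - t ∧ (x v).2 ∈ Set.Ico (j * ω) (j * ω + ω))}
  set A₂ := {x : Fin n → ℝ × ℝ | N ^ 2 ≤ (Finset.univ.filter fun p : Fin n × Fin n =>
        (x p.1, x p.2) ∈ closePairs ω).card}
  set A₃ := {x : Fin n → ℝ × ℝ | ∀ s : Fin M, ∀ e : Option (Option (Fin L)) ↪ Fin n,
        x ∉ patternEvent (pathBox R t (s / M)) (pathFan R (s / M) L) e}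
  set A₀ := {x : Fin n → ℝ × ℝ | ¬ ∀ v, x v ∈ Set.Icc 0 R ×ˢ Set.Ico 0 (2 * Real.pi)}
  have h₀ : P.real A₀ = 0 := by
    have h1 : ∀ v, ∀ᵐ x ∂P, x v ∈ Set.Icc 0 R ×ˢ Set.Ico 0 (2 * Real.pi) := by
      intro v
      have h2 : ∀ᵐ p ∂nodeLaw α R, p ∈ Set.Icc 0 R ×ˢ Set.Ico 0 (2 * Real.pi) :=
        nodeLaw_compl_support hα hR0
      exact (measurePreserving_eval (fun _ : Fin n => nodeLaw α R) v).quasiMeasurePreserving.ae h2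
    have h3 : P A₀ = 0 := ae_all_iff.2 h1
    rw [measureReal_def, h3, ENNReal.toReal_zero]
  have hcover : Set.univ ⊆ G ∪ (A₀ ∪ (A₁ ∪ (A₂ ∪ A₃))) := by
    intro x _
    by_contra hx
    simp only [Set.mem_union, not_or] at hx
    obtain ⟨hG, hx0, hx1, hx2, hx3⟩ := hx
    simp only [A₀, A₁, A₂, A₃, Set.mem_ofPred_eq, not_not, not_exists, not_and, not_forall,
      not_le] at hx0 hx1 hx2 hx3
    obtain ⟨s, e, hpat⟩ := hx3
    apply hG
    intro K hK
    have hmem : ∀ v, (x v).1 ≤ R - t → v ∈ K.supp := by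
      intro v hv
      refine mem_giant_of_radius_le hR0.le ht hN hω hωt hx0 (fun j hj => ?_) ?_ hK hv
      · obtain ⟨v, hv1, hv2⟩ := hx1 j hj
        exact ⟨v, hv1, hv2⟩
      · exact hx2
    have := sub_one_le_mul_diam_of_pattern ht0 hL hRt hsmall hx0 e hpat hmem
    linarith
  have hone : (1 : ℝ) = P.real Set.univ := by simp
  have h4 := measureReal_mono hcover (measure_ne_top P _)
  have h5 := measureReal_union_le (μ := P) G (A₀ ∪ (A₁ ∪ (A₂ ∪ A₃)))
  have h6 := measureReal_union_le (μ := P) A₀ (A₁ ∪ (A₂ ∪ A₃))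
  have h7 := measureReal_union_le (μ := P) A₁ (A₂ ∪ A₃)
  have h8 := measureReal_union_le (μ := P) A₂ A₃
  linarith

/-! ### Asymptotics of the error terms -/

/-- A sequence that is eventually at most a negative power of `n`, up to a constant. -/
def PolySmall (f : ℕ → ℝ) : Prop :=
  ∃ γ > 0, ∃ K, ∀ᶠ n : ℕ in atTop, f n ≤ K * Real.exp (-(γ * Real.log n))

theorem tendsto_log_natCast : Tendsto (fun n : ℕ => Real.log n) atTop atTop :=
  Real.tendsto_log_atTop.comp tendsto_natCast_atTop_atTop

theorem PolySmall.add {f g : ℕ → ℝ} (hf : PolySmall f) (hg : PolySmall g) :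
    PolySmall fun n => f n + g n := by
  obtain ⟨γ, hγ, K, hK⟩ := hf
  obtain ⟨γ', hγ', K', hK'⟩ := hg
  refine ⟨min γ γ', lt_min hγ hγ', |K| + |K'|, ?_⟩
  filter_upwards [hK, hK', tendsto_log_natCast.eventually_ge_atTop 0] with n h h' hn
  rw [add_mul]
  refine add_le_add (h.trans ?_) (h'.trans ?_)
  · refine mul_le_mul (le_abs_self _) (Real.exp_le_exp.2 ?_) (Real.exp_pos _).le (abs_nonneg _)
    nlinarith [min_le_left γ γ']
  · refine mul_le_mul (le_abs_self _) (Real.exp_le_exp.2 ?_) (Real.exp_pos _).le (abs_nonneg _)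
    nlinarith [min_le_right γ γ']

theorem PolySmall.exists_le_rpow {f : ℕ → ℝ} (hf : PolySmall f) :
    ∃ γ : ℝ, 0 < γ ∧ ∀ᶠ n : ℕ in atTop, f n ≤ (n : ℝ) ^ (-γ) := by
  obtain ⟨γ, hγ, K, hK⟩ := hf
  refine ⟨γ / 2, by positivity, ?_⟩
  filter_upwards [hK, tendsto_log_natCast.eventually_ge_atTop (|K| / (γ / 2)),
    eventually_gt_atTop 0] with n h hn hn0
  have hn0' : (0 : ℝ) < n := by exact_mod_cast hn0
  rw [Real.rpow_def_of_pos hn0']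
  refine h.trans ?_
  rw [div_le_iff₀ (by positivity)] at hn
  have h1 : K ≤ Real.exp (Real.log n * (γ / 2)) := by
    linarith [le_abs_self K, Real.add_one_le_exp (Real.log n * (γ / 2))]
  calc _ ≤ Real.exp (Real.log n * (γ / 2)) * Real.exp (-(γ * Real.log n)) := by gcongr
    _ = _ := by rw [← Real.exp_add]; ring_nf

/-- The number of sectors. -/
noncomputable def sectorCount (C ε : ℝ) (n : ℕ) : ℕ :=
  -- With $t=\varepsilon\log n$, the factor $4\pi$ yields $2\omega=4\pi/N\le e^{t-R/2}$, which makes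
  -- deep nodes of neighbouring sectors adjacent.
  ⌈4 * Real.pi * Real.exp (radius C n / 2 - ε * Real.log n)⌉₊

theorem exp_radius_half (C ε : ℝ) (n : ℕ) :
    Real.exp (radius C n / 2 - ε * Real.log n)
      = Real.exp (C / 2) * Real.exp ((1 - ε) * Real.log n) := by
  rw [← Real.exp_add]; unfold radius; ring_nf

theorem le_sectorCount (C ε : ℝ) (n : ℕ) :
    4 * Real.pi * Real.exp (C / 2) * Real.exp ((1 - ε) * Real.log n) ≤ sectorCount C ε n := by
  rw [mul_assoc, ← exp_radius_half]
  exact Nat.le_ceil _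

theorem sectorCount_le {C ε : ℝ} (hε : ε ≤ 1) {n : ℕ} (hn : 0 ≤ Real.log n) :
    (sectorCount C ε n : ℝ)
      ≤ (4 * Real.pi * Real.exp (C / 2) + 1) * Real.exp ((1 - ε) * Real.log n) := by
  refine (Nat.ceil_lt_add_one (by positivity)).le.trans ?_
  rw [exp_radius_half]
  have h1 : 1 ≤ Real.exp ((1 - ε) * Real.log n) :=
    Real.one_le_exp (mul_nonneg (by linarith) hn)
  linarith

/-- The exponent is at least of order $n^{\varepsilon(1-\alpha)}$, a positive power of $n$ because
$\alpha<1$, so the exponential beats the number of sectors. -/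
theorem polySmall_empty_sector {α ε : ℝ} (C : ℝ) (hα : 0 < α) (hα1 : α < 1) (hε : 0 < ε)
    (hε1 : ε ≤ 1) :
    PolySmall fun n => sectorCount C ε n * Real.exp (-(n * ((Real.cosh α - 1) / 2
      * Real.exp (-(α * (ε * Real.log n + 1))) / sectorCount C ε n))) := by
  set K := 4 * Real.pi * Real.exp (C / 2) + 1
  have hK : 0 < K := by positivity
  have hcosh : 0 < (Real.cosh α - 1) / 2 := by
    have := Real.one_lt_cosh.2 hα.ne'
    linarith
  set κ := (Real.cosh α - 1) / 2 * Real.exp (-α) / K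
  have hκ : 0 < κ := by positivity
  set δ := ε * (1 - α)
  have hδ : 0 < δ := mul_pos hε (by linarith)
  have hlim : Tendsto (fun n : ℕ => Real.exp (δ * Real.log n)) atTop atTop :=
    Real.tendsto_exp_atTop.comp (tendsto_log_natCast.const_mul_atTop hδ)
  -- With $y=n^\delta$, the bound $e^{-\kappa y}\le y^{-2/\delta}$ reads $e^{-\kappa y}\le n^{-2}$.
  have hO := ((isLittleO_exp_neg_mul_rpow_atTop hκ (-(2 / δ))).comp_tendsto hlim).bound
    (c := 1) one_pos
  refine ⟨1, one_pos, K, ?_⟩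
  filter_upwards [hO, tendsto_log_natCast.eventually_ge_atTop 0, eventually_gt_atTop 0]
    with n h hn hn0
  have hn0' : (0 : ℝ) < n := by exact_mod_cast hn0
  set ℓ := Real.log n
  have hnℓ : (n : ℝ) = Real.exp ℓ := (Real.exp_log hn0').symm
  have hNle := sectorCount_le (C := C) hε1 hn
  have hNpos : (0 : ℝ) < sectorCount C ε n :=
    lt_of_lt_of_le (by positivity) (le_sectorCount C ε n)
  simp only [Function.comp_apply, Real.norm_eq_abs, Real.abs_exp, one_mul] at h
  rw [abs_of_pos (by positivity), ← Real.exp_mul] at h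
  have h1 : δ * ℓ * -(2 / δ) = -(2 * ℓ) := by field_simp
  rw [h1] at h
  have h2 : κ * Real.exp (δ * ℓ) ≤ n * ((Real.cosh α - 1) / 2
      * Real.exp (-(α * (ε * ℓ + 1))) / sectorCount C ε n) := by
    rw [mul_div_assoc', le_div_iff₀ hNpos]
    calc κ * Real.exp (δ * ℓ) * sectorCount C ε n
        ≤ κ * Real.exp (δ * ℓ) * (K * Real.exp ((1 - ε) * ℓ)) := by gcongr
      _ = (Real.cosh α - 1) / 2 * (Real.exp (-α) * Real.exp (δ * ℓ) * Real.exp ((1 - ε) * ℓ)) := by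
          simp only [κ]; field_simp
      _ = (Real.cosh α - 1) / 2 * (n * Real.exp (-(α * (ε * ℓ + 1)))) := by
          rw [hnℓ, ← Real.exp_add, ← Real.exp_add, ← Real.exp_add]
          simp only [δ]; ring_nf
      _ ≤ _ := le_of_eq (by ring)
  calc _ ≤ K * Real.exp ((1 - ε) * ℓ) * Real.exp (-(2 * ℓ)) := by
        refine mul_le_mul hNle (le_trans (Real.exp_le_exp.2 ?_) h) (Real.exp_pos _).le
          (by positivity)
        linarith
    _ ≤ K * Real.exp ℓ * Real.exp (-(2 * ℓ)) := by
        gcongr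
        nlinarith
    _ = _ := by rw [mul_assoc, ← Real.exp_add]; ring_nf

theorem polySmall_closePairs {ε : ℝ} (C : ℝ) (hε : 0 < ε) (hε3 : ε < 1 / 3) :
    PolySmall fun n => ((n : ℝ) + 10 * n ^ 2 / sectorCount C ε n) / sectorCount C ε n ^ 2 := by
  set κ := 4 * Real.pi * Real.exp (C / 2)
  have hκ : 0 < κ := by positivity
  refine ⟨1 - 3 * ε, by linarith, (1 + 10 / κ) / κ ^ 2, ?_⟩
  filter_upwards [tendsto_log_natCast.eventually_ge_atTop 0, eventually_gt_atTop 0]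
    with n hn hn0
  have hn0' : (0 : ℝ) < n := by exact_mod_cast hn0
  set ℓ := Real.log n
  have hnℓ : (n : ℝ) = Real.exp ℓ := (Real.exp_log hn0').symm
  have hN := le_sectorCount C ε n
  change κ * Real.exp ((1 - ε) * ℓ) ≤ _ at hN
  have h1 : (n : ℝ) + 10 * n ^ 2 / sectorCount C ε n
      ≤ (1 + 10 / κ) * Real.exp ((1 + ε) * ℓ) := by
    calc (n : ℝ) + 10 * n ^ 2 / sectorCount C ε n
        ≤ Real.exp ((1 + ε) * ℓ) + 10 * n ^ 2 / (κ * Real.exp ((1 - ε) * ℓ)) := by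
          gcongr
          rw [hnℓ]
          exact Real.exp_le_exp.2 (by nlinarith)
      _ = _ := by
          have : (n : ℝ) ^ 2 = Real.exp ((1 + ε) * ℓ) * Real.exp ((1 - ε) * ℓ) := by
            rw [hnℓ, ← Real.exp_nat_mul, ← Real.exp_add]; congr 1; push_cast; ring
          rw [this]
          field_simp
  calc _ ≤ (1 + 10 / κ) * Real.exp ((1 + ε) * ℓ) / (κ * Real.exp ((1 - ε) * ℓ)) ^ 2 := by
        gcongr
    _ = _ := by
        have : Real.exp ((1 + ε) * ℓ) = Real.exp (-((1 - 3 * ε) * ℓ))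
            * Real.exp ((1 - ε) * ℓ) ^ 2 := by
          rw [← Real.exp_nat_mul, ← Real.exp_add]; congr 1; push_cast; ring
        rw [this]
        field_simp


/-- The number of nodes of the dangling paths. -/
noncomputable def pathLength (c : ℝ) (n : ℕ) : ℕ := ⌈c * Real.log n⌉₊

/-- The number of angles at which a dangling path may occur. -/
noncomputable def angleCount (m : ℝ) (n : ℕ) : ℕ := ⌈Real.exp (m * Real.log n)⌉₊

theorem pathLength_le {c : ℝ} (hc : 0 ≤ c) {n : ℕ} (hn : 0 ≤ Real.log n) :
    (pathLength c n : ℝ) ≤ c * Real.log n + 1 :=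
  (Nat.ceil_lt_add_one (mul_nonneg hc hn)).le

theorem angleCount_le {m : ℝ} (hm : 0 ≤ m) {n : ℕ} (hn : 0 ≤ Real.log n) :
    (angleCount m n : ℝ) ≤ 2 * Real.exp (m * Real.log n) := by
  refine (Nat.ceil_lt_add_one (Real.exp_pos _).le).le.trans ?_
  linarith [Real.one_le_exp (mul_nonneg hm hn)]

theorem exp_neg_radius_half (C : ℝ) {n : ℕ} (hn : 0 < n) :
    Real.exp (-radius C n / 2) = Real.exp (-C / 2) / n := by
  have hn0 : (0 : ℝ) < n := by exact_mod_cast hn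
  rw [eq_div_iff hn0.ne']
  conv_lhs => rw [← Real.exp_log hn0]
  rw [← Real.exp_add]
  unfold radius
  ring_nf

/-- The geometric side conditions on the pattern hold for large `n`. -/
theorem eventually_path_fits {c m ε H : ℝ} (C : ℝ) (hc : 0 < c) (hm : 0 < m) (hm4 : m ≤ 1 / 4)
    (hε2 : ε ≤ 1 / 2) (hH : 0 ≤ H) :
    ∀ᶠ n : ℕ in atTop,
      (angleCount m n * (4 * (pathLength c n + 1) * Real.exp (-radius C n / 2)
        + 1000 * Real.exp (ε * Real.log n / 2) * Real.exp (-radius C n / 2)) ≤ 1) ∧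
      pathLength c n + 2 + (pathLength c n + 2) ≤ n ∧
      (pathLength c n + H) * Real.exp (-radius C n / 2) ≤ 1 / 2 ∧
      4 * ((pathLength c n + H) * Real.exp (-radius C n / 2)) * (pathLength c n + 2)
        ≤ 4 * (4 * c + 1 + H) * (4 * c + 3) * Real.exp (-C / 2) * Real.exp (-(1 / 2 * Real.log n)) ∧
      2 * Real.log (120 * angleCount m n) ≤ radius C n := by
  set A := Real.exp (-C / 2)
  have hA : 0 < A := Real.exp_pos _
  have hz : Tendsto (fun n : ℕ => Real.exp (1 / 4 * Real.log n)) atTop atTop :=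
    Real.tendsto_exp_atTop.comp (tendsto_log_natCast.const_mul_atTop (by norm_num))
  filter_upwards [tendsto_log_natCast.eventually_ge_atTop 0,
    tendsto_log_natCast.eventually_ge_atTop (2 * Real.log 240 - C), eventually_gt_atTop 0,
    hz.eventually_ge_atTop (2 * A * (16 * c + 1008)),
    hz.eventually_ge_atTop (2 * (4 * c + 3)), hz.eventually_ge_atTop (2 * (4 * c + 1 + H) * A)]
    with n hn hn1 hn0 z1 z2 z3
  rw [exp_neg_radius_half C hn0]
  have hn0' : (0 : ℝ) < n := by exact_mod_cast hn0
  have hL := pathLength_le hc.le hn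
  have hM := angleCount_le hm.le hn
  set L := (pathLength c n : ℝ) with hL_def
  set M := (angleCount m n : ℝ)
  set ℓ := Real.log n with hℓ
  -- All quantities are compared with powers of $z=n^{1/4}$: $\log n\le4z$, $M\le2z$,
  -- $e^{\varepsilon\ell/2}\le z$ and $n=z^4$.
  set z := Real.exp (1 / 4 * ℓ) with hz_def
  have hz1 : 1 ≤ z := Real.one_le_exp (by positivity)
  have hnz : (n : ℝ) = z ^ 4 := by
    rw [hz_def, ← Real.exp_nat_mul, ← Real.exp_log hn0', ← hℓ]; congr 1; push_cast; ring
  have hℓz : ℓ ≤ 4 * z := by linarith [Real.add_one_le_exp (1 / 4 * ℓ)]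
  have hMz : M ≤ 2 * z := by
    have : Real.exp (m * ℓ) ≤ z := Real.exp_le_exp.2 (by nlinarith)
    linarith
  have hTz : Real.exp (ε * ℓ / 2) ≤ z := Real.exp_le_exp.2 (by nlinarith)
  have hL1 : L + 1 ≤ (4 * c + 2) * z := by nlinarith
  have hL2 : L + H ≤ (4 * c + 1 + H) * z := by nlinarith
  have hL3 : L + 2 ≤ (4 * c + 3) * z := by nlinarith
  have hL0 : 0 ≤ L := Nat.cast_nonneg _
  have hM0 : 0 ≤ M := Nat.cast_nonneg _
  have hz0 : 0 < z := by linarith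
  rw [hnz]
  refine ⟨?_, ?_, ?_, ?_, ?_⟩
  · calc M * (4 * (L + 1) * (A / z ^ 4) + 1000 * Real.exp (ε * ℓ / 2) * (A / z ^ 4))
        ≤ 2 * z * (4 * ((4 * c + 2) * z) * (A / z ^ 4) + 1000 * z * (A / z ^ 4)) := by
          gcongr
      _ = 2 * A * (16 * c + 1008) / z ^ 2 := by field_simp; ring
      _ ≤ 1 := by
          rw [div_le_one (by positivity)]
          nlinarith
  · have h1 : L + 2 + (L + 2) ≤ (n : ℝ) := by
      rw [hnz]
      have : z ^ 2 ≤ z ^ 4 := pow_le_pow_right₀ hz1 (by norm_num)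
      nlinarith
    rw [hL_def] at h1
    exact_mod_cast h1
  · calc (L + H) * (A / z ^ 4) ≤ (4 * c + 1 + H) * z * (A / z ^ 4) := by gcongr
      _ = (4 * c + 1 + H) * A / z ^ 3 := by field_simp
      _ ≤ 1 / 2 := by
          rw [div_le_iff₀ (by positivity)]
          have : z ^ 1 ≤ z ^ 3 := pow_le_pow_right₀ hz1 (by norm_num)
          linarith
  · have h1 : Real.exp (-(1 / 2 * ℓ)) = 1 / z ^ 2 := by
      rw [eq_div_iff (pow_pos hz0 2).ne', hz_def, ← Real.exp_nat_mul, ← Real.exp_add,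
        ← Real.exp_zero]
      congr 1; push_cast; ring
    rw [h1]
    calc 4 * ((L + H) * (A / z ^ 4)) * (L + 2)
        ≤ 4 * ((4 * c + 1 + H) * z * (A / z ^ 4)) * ((4 * c + 3) * z) := by gcongr
      _ = _ := by field_simp
  · have hMpos : 0 < M := lt_of_lt_of_le (Real.exp_pos (m * ℓ)) (Nat.le_ceil _)
    have h1 : Real.log (120 * M) ≤ Real.log (240 * Real.exp (m * ℓ)) :=
      Real.log_le_log (by positivity) (by linarith)
    rw [Real.log_mul (by norm_num) (Real.exp_pos _).ne', Real.log_exp] at h1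
    unfold radius
    rw [← hℓ]
    nlinarith

/-- Boxes and empty fan cost at most $e^{-(L+2)B}$, which is $n^{-m/4}$ up to a constant by
$cB=m/4$. The deep box costs at most another $n^{-m/4}$, so $n^m$ sites leave a mean of order
$n^{m/2}$. -/
theorem exp_le_mean {κ A H B m c ℓ τ M : ℝ} {L : ℕ} (hκ : 0 < κ) (hA : 0 ≤ A) (hH : 0 ≤ H)
    (hB : |Real.log κ| + 2 * A * (1 + H) = B) (hcB : c * B = m / 4) (hτ : τ ≤ m / 4 * ℓ)
    (hM : Real.exp (m * ℓ) ≤ M) (hL : L ≤ c * ℓ + 1) :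
    Real.exp (m / 2 * ℓ - 3 * B)
      ≤ M * κ ^ (L + 2) * Real.exp (-τ) * Real.exp (-(2 * A * (L + H))) := by
  have hL0 : (0 : ℝ) ≤ L := Nat.cast_nonneg L
  have hlog := abs_nonneg (Real.log κ)
  have hB0 : 0 ≤ B := by rw [← hB]; positivity
  have hM0 : 0 ≤ M := (Real.exp_pos _).le.trans hM
  have h3 : Real.exp (-((L + 2) * |Real.log κ|)) ≤ κ ^ (L + 2) := by
    calc _ ≤ Real.exp ((L + 2 : ℕ) * Real.log κ) := by
          apply Real.exp_le_exp.2
          push_cast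
          nlinarith [neg_abs_le (Real.log κ)]
      _ = _ := by rw [Real.exp_nat_mul, Real.exp_log hκ]
  have h5 : (L + 2) * |Real.log κ| + 2 * A * (L + H) ≤ (L + 2) * B := by
    have h : (L : ℝ) + H ≤ (L + 2) * (1 + H) := by nlinarith
    have := mul_le_mul_of_nonneg_left h (by positivity : 0 ≤ 2 * A)
    rw [← hB]
    linarith
  have h6 : ((L : ℝ) + 2) * B ≤ m / 4 * ℓ + 3 * B := by
    have := mul_le_mul_of_nonneg_right hL hB0
    linear_combination this + ℓ * hcB
  calc Real.exp (m / 2 * ℓ - 3 * B) ≤ Real.exp (m * ℓ + -((L + 2) * |Real.log κ|)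
        + -τ + -(2 * A * (L + H))) := Real.exp_le_exp.2 (by linarith)
    _ = Real.exp (m * ℓ) * Real.exp (-((L + 2) * |Real.log κ|))
        * Real.exp (-τ) * Real.exp (-(2 * A * (L + H))) := by
        rw [Real.exp_add, Real.exp_add, Real.exp_add]
    _ ≤ _ := by gcongr

set_option maxHeartbeats 1000000 in
theorem polySmall_no_path {α m ε : ℝ} (C : ℝ) (hα : 1 / 2 < α) (hα1 : α < 1) (hm : 0 < m)
    (hm4 : m ≤ 1 / 4) (hmα : 4 * α * m ≤ 2 * α - 1) (hε : ε = m / 4) :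
    ∃ c > 0, ∃ f : ℕ → ℝ, PolySmall f ∧ ∀ᶠ n : ℕ in atTop,
      ((pathLength c n + 1) * Real.exp (-radius C n / 2)
        + 1000 * Real.exp (ε * Real.log n / 2) * Real.exp (-radius C n / 2) ≤ 1) ∧
      (Measure.pi fun _ : Fin n => nodeLaw α (radius C n)).real
      {x | ∀ s : Fin (angleCount m n), ∀ e : Option (Option (Fin (pathLength c n))) ↪ Fin n,
        x ∉ patternEvent (pathBox (radius C n) (ε * Real.log n) (s / angleCount m n))
          (pathFan (radius C n) (s / angleCount m n) (pathLength c n)) e} ≤ f n := by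
  have hα0 : 0 < α := by linarith
  have hε0 : 0 < ε := by rw [hε]; positivity
  set H := 30 * (2 * α / (α - 1 / 2))
  have hH : 0 ≤ H := by
    have : 0 < α - 1 / 2 := by linarith
    positivity
  set A := Real.exp (-C / 2)
  have hA : 0 < A := Real.exp_pos _
  set κ := boxMass α * (A / 2)
  have hκ : 0 < κ := mul_pos (boxMass_pos hα0) (by positivity)
  set B := |Real.log κ| + 2 * A * (1 + H)
  have hB : 0 < B := by positivity
  set c := m / (4 * B) with hc_def
  have hc : 0 < c := by positivity
  have hcB : c * B = m / 4 := by rw [hc_def]; field_simp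
  set K₁ := 4 * (4 * c + 1 + H) * (4 * c + 3) * A
  have hK₁ : 0 ≤ K₁ := by positivity
  set K₂ := 16 * Real.exp (-(α * C) + 2 * α * Real.log 240)
  have hK₂ : 0 ≤ K₂ := by positivity
  have h₁ : PolySmall fun n => Real.exp (3 * B) * Real.exp (-(m / 2 * Real.log n)) :=
    ⟨m / 2, by positivity, _, Eventually.of_forall fun n => le_rfl⟩
  have h₂ : PolySmall fun n => 2 * (K₂ * Real.exp (-((2 * α - 1) / 2 * Real.log n))) :=
    ⟨(2 * α - 1) / 2, by linarith, 2 * K₂, Eventually.of_forall fun n => le_of_eq (by ring)⟩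
  have h₃ : PolySmall fun n => 2 * (K₁ * Real.exp (-(1 / 2 * Real.log n))) :=
    ⟨1 / 2, by norm_num, 2 * K₁, Eventually.of_forall fun n => le_of_eq (by ring)⟩
  have hlim : ∀ γ > 0, ∀ K, ∀ᶠ n : ℕ in atTop, K * Real.exp (-(γ * Real.log n)) ≤ 1 / 2 := by
    intro γ hγ K
    have h1 : Tendsto (fun n : ℕ => K * Real.exp (-(γ * Real.log n))) atTop (nhds (K * 0)) :=
      (Real.tendsto_exp_neg_atTop_nhds_zero.comp
        (tendsto_log_natCast.const_mul_atTop hγ)).const_mul K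
    rw [mul_zero] at h1
    exact h1.eventually_le_const (by norm_num)
  refine ⟨c, hc, _, h₁.add (h₂.add h₃), ?_⟩
  filter_upwards [eventually_path_fits (ε := ε) C hc hm hm4 (by rw [hε]; linarith) hH,
    tendsto_log_natCast.eventually_ge_atTop (10 - C), tendsto_log_natCast.eventually_gt_atTop 0,
    tendsto_log_natCast.eventually_ge_atTop (4 / α - C), eventually_gt_atTop 0,
    hlim _ (by linarith : 0 < (2 * α - 1) / 2) K₂, hlim (1 / 2) (by norm_num) K₁]
    with n hfits hlog1 hlog0 hlog2 hn0 hy1 hy2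
  obtain ⟨hfit, hLn, hb, hbL, hMR⟩ := hfits
  have hn0' : (0 : ℝ) < n := by exact_mod_cast hn0
  have hLle := pathLength_le hc.le hlog0.le
  have hMle := angleCount_le hm.le hlog0.le
  have hMge : Real.exp (m * Real.log n) ≤ angleCount m n := Nat.le_ceil _
  have hM1 : 1 ≤ angleCount m n := Nat.one_le_ceil_iff.2 (Real.exp_pos _)
  have hL1 : 1 ≤ pathLength c n := Nat.one_le_ceil_iff.2 (mul_pos hc hlog0)
  have haeq : n * Real.exp (-radius C n / 2) = A := by
    rw [exp_neg_radius_half C hn0]; field_simp; simp only [A]; ring_nf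
  have hR_def : radius C n = 2 * Real.log n + C := rfl
  set L := pathLength c n
  set M := angleCount m n
  set ℓ := Real.log n with hℓ
  set R := radius C n
  have ha : 0 < Real.exp (-R / 2) := Real.exp_pos _
  have hM1' : (1 : ℝ) ≤ M := by exact_mod_cast hM1
  have hMpos : (0 : ℝ) < M := by linarith
  refine ⟨?_, ?_⟩
  · have h4 : 0 ≤ 4 * (L + 1) * Real.exp (-R / 2)
        + 1000 * Real.exp (ε * ℓ / 2) * Real.exp (-R / 2) := by positivity
    have h5 : 0 ≤ (L + 1) * Real.exp (-R / 2) := by positivity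
    have h6 := (le_mul_of_one_le_left h4 hM1').trans hfit
    linarith
  have hmain := measureReal_no_path_le (α := α) (R := R) (t := ε * ℓ) (n := n) (L := L) (M := M)
    hα (by positivity) (by rw [hR_def, hε]; nlinarith [mul_le_mul_of_nonneg_right hm4 hlog0.le]) ?_
    hL1 hM1 hfit hLn rfl hb hMR rfl
  swap
  · have h1 : (4 : ℝ) ≤ α * R := by
      rw [hR_def]
      have : α * (4 / α) = 4 := by field_simp
      nlinarith
    linarith [Real.add_one_le_exp (α * R)]
  refine hmain.trans ?_
  set b := (L + H) * Real.exp (-R / 2)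
  set v := 4 * Real.exp (-(α * (R - 2 * Real.log (120 * M))))
  have hb0 : 0 ≤ b := by positivity
  -- Here $n\cdot n^{-2\alpha(1-m)}\le n^{-(2\alpha-1)/2}$, by $4\alpha m\le2\alpha-1$.
  have hv : 4 * v * n ≤ K₂ * Real.exp (-((2 * α - 1) / 2 * ℓ)) := by
    have h1 : Real.log (120 * M) ≤ Real.log 240 + m * ℓ := by
      rw [← Real.log_exp (m * ℓ), ← Real.log_mul (by norm_num) (Real.exp_pos _).ne']
      exact Real.log_le_log (by positivity) (by linarith)
    calc 4 * v * n = 16 * Real.exp (-(α * (R - 2 * Real.log (120 * M))) + ℓ) := by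
          rw [Real.exp_add, hℓ, Real.exp_log hn0']; ring
      _ ≤ 16 * Real.exp ((-(α * C) + 2 * α * Real.log 240) + -((2 * α - 1) / 2 * ℓ)) := by
          refine mul_le_mul_of_nonneg_left (Real.exp_le_exp.2 ?_) (by norm_num)
          rw [hR_def]
          have h2 := mul_le_mul_of_nonneg_left h1 hα0.le
          have h3 := mul_le_mul_of_nonneg_right hmα hlog0.le
          linarith
      _ = _ := by rw [Real.exp_add]; ring
  -- The bound $e^x-1\le2x$ needs $x\le1$; `hy1` and `hy2` bound the two summands by $1/2$ each.
  have hexp : Real.exp (4 * v * n + 4 * b * (L + 2)) - 1 ≤ 2 * (4 * v * n + 4 * b * (L + 2)) := by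
    have h0 : 0 ≤ 4 * v * n + 4 * b * (L + 2) := by positivity
    have h1 := Real.abs_exp_sub_one_le (x := 4 * v * n + 4 * b * (L + 2))
      (by rw [abs_of_nonneg h0]; linarith)
    rw [abs_of_nonneg h0] at h1
    exact (le_abs_self _).trans h1
  have hmean : 1 / (M * (boxMass α * (n * Real.exp (-R / 2) / 2)) ^ (L + 2)
      * Real.exp (-(α * (ε * ℓ))) * Real.exp (-(2 * b * n)))
      ≤ Real.exp (3 * B) * Real.exp (-(m / 2 * ℓ)) := by
    have h1 : boxMass α * (n * Real.exp (-R / 2) / 2) = κ := by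
      rw [haeq]
    have h2 : 2 * b * n = 2 * A * (L + H) := by
      simp only [b]; linear_combination 2 * (L + H) * haeq
    have h4 := exp_le_mean hκ hA.le hH rfl hcB (τ := α * (ε * ℓ))
      (by rw [hε]; nlinarith [mul_pos hm hlog0]) hMge hLle
    rw [← h2] at h4
    rw [h1]
    calc _ ≤ 1 / Real.exp (m / 2 * ℓ - 3 * B) := one_div_le_one_div_of_le (Real.exp_pos _) h4
      _ = _ := by rw [one_div, ← Real.exp_neg, ← Real.exp_add]; ring_nf
  linarith

end HyperbolicRandomGraph

/-! ### Conclusion -/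

theorem theorem2 (α β C : ℝ) (hβα : β = 2 * α + 1) (hβ2 : 2 < β) (hβ3 : β < 3) :
    ∃ c : ℝ, 0 < c ∧ ∃ γ : ℝ, 0 < γ ∧ ∀ᶠ n : ℕ in atTop,
      1 - (n : ℝ) ^ (-γ) ≤
        (HyperbolicRandomGraph.positionLaw α C n).real
          {x | ∀ K : (HyperbolicRandomGraph.graph
                (HyperbolicRandomGraph.radius C n) x).ConnectedComponent,
              HyperbolicRandomGraph.IsGiant K →
                c * Real.log n ≤ (K.toSimpleGraph.diam : ℝ)} := by
  open HyperbolicRandomGraph in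
  have hα : 1 / 2 < α := by linarith
  have hα0 : 0 < α := by linarith
  have hα1 : α < 1 := by linarith
  -- As $\alpha<1$, this choice satisfies both $m\le1/4$ and $4\alpha m\le2\alpha-1$.
  set m := (2 * α - 1) / 4 with hm_def
  have hm : 0 < m := by rw [hm_def]; linarith
  have hm4 : m ≤ 1 / 4 := by rw [hm_def]; linarith
  obtain ⟨c, hc, f, hf, hpath⟩ := polySmall_no_path (ε := m / 4) C hα hα1 hm hm4
    (by rw [hm_def]; nlinarith) rfl
  have hε : 0 < m / 4 := by linarith
  obtain ⟨γ, hγ, hsmall⟩ := (((polySmall_empty_sector C hα0 hα1 hε (by linarith)).add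
    (polySmall_closePairs C hε (by linarith))).add hf).exists_le_rpow
  -- Since $3248=2\cdot1624$, the requirement becomes $c\ell/2\le L-1$, which holds once
  -- $c\ell\ge2$.
  refine ⟨c / 3248, by positivity, γ, hγ, ?_⟩
  filter_upwards [hpath, hsmall, tendsto_log_natCast.eventually_ge_atTop (10 - C),
    tendsto_log_natCast.eventually_gt_atTop 0, tendsto_log_natCast.eventually_ge_atTop (2 / c),
    tendsto_log_natCast.eventually_ge_atTop (3 / (m / 4))]
    with n ⟨hfit, hno_path⟩ hbad hlog1 hlog0 hlog2 hlog3
  rw [div_le_iff₀ hc] at hlog2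
  rw [div_le_iff₀ hε] at hlog3
  set ℓ := Real.log n
  have hR : radius C n = 2 * ℓ + C := rfl
  have hNpos : (0 : ℝ) < sectorCount C (m / 4) n :=
    lt_of_lt_of_le (by positivity) (le_sectorCount C (m / 4) n)
  have hN : 0 < sectorCount C (m / 4) n := by exact_mod_cast hNpos
  have hω : sectorCount C (m / 4) n * (2 * Real.pi / sectorCount C (m / 4) n) = 2 * Real.pi := by
    field_simp
  have hRt : m / 4 * ℓ + 10 ≤ radius C n := by rw [hR]; nlinarith
  have ht0 : 0 ≤ m / 4 * ℓ := by positivity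
  have hL : c * ℓ ≤ pathLength c n := Nat.le_ceil _
  refine le_trans ?_ (one_sub_le_measureReal_diam (R := radius C n) (t := m / 4 * ℓ)
    (ω := 2 * Real.pi / sectorCount C (m / 4) n) (L := pathLength c n) (M := angleCount m n)
    hα0 rfl (by linarith [Real.add_one_le_exp (m / 4 * ℓ)]) ht0 hRt hN hω ?_
    (Nat.one_le_ceil_iff.2 (mul_pos hc hlog0)) hfit (by linarith)
    (measureReal_exists_empty_sector_le hα0 ht0 (by linarith) hN hω)
    (measureReal_many_closePairs_le hα0 (by linarith) hN hω) hno_path)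
  · linarith
  · rw [mul_div_assoc', div_le_iff₀ hNpos]
    have h1 : 4 * Real.pi * Real.exp (radius C n / 2 - m / 4 * ℓ) ≤ sectorCount C (m / 4) n :=
      Nat.le_ceil _
    have h2 : Real.exp (m / 4 * ℓ - radius C n / 2) * Real.exp (radius C n / 2 - m / 4 * ℓ) = 1 := by
      rw [← Real.exp_add]; simp
    have h3 := mul_le_mul_of_nonneg_left h1 (Real.exp_pos (m / 4 * ℓ - radius C n / 2)).le
    calc 2 * (2 * Real.pi) = Real.exp (m / 4 * ℓ - radius C n / 2)
          * (4 * Real.pi * Real.exp (radius C n / 2 - m / 4 * ℓ)) := by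
          linear_combination -(4 * Real.pi) * h2
      _ ≤ _ := h3
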